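/- Let $\Omega$ be a compact metric space and $T:\Omega\to\Omega$ a homeomorphism such that $(\Omega,T)$ is strictly ergodic, i.e. every orbit $\{T^n\omega : n\in\mathbb{Z}\}$ is dense in $\Omega$ and there is exactly one $T$-invariant Borel probability measure $\mu$ on $\Omega$. Let $f:\Omega\to\mathbb{R}$ be continuous, and for $\omega\in\Omega$ let $H_\omega$ be the bounded operator on $\ell^2(\mathbb{Z})$ given by $$(H_\omega u)(n)=u(n+1)+u(n-1)+f(T^n\omega)\,u(n).$$ For a continuous function $A:\Omega\to GL(2,\mathbb{R})$ put $A(n,\omega)=A(T^{n-1}\omega)\cdots A(\omega)$ for $n>0$, $A(0,\omega)=\mathrm{Id}$, and $A(n,\omega)=A^{-1}(T^{n}\omega)\cdots A^{-1}(T^{-1}\omega)$ for $n<0$. Let $\Lambda(A)$ be the number with $\Lambda(A)=\lim_{|n|\to\infty}\frac1{|n|}\log\|A(n,\omega)\|$ for $\mu$-almost every $\omega$, where $\|\cdot\|$ is the operator norm. The function $A$ is called uniform if this limit exists and equals $\Lambda(A)$ for all $\omega\in\Omega$, with uniform convergence on $\Omega$. For $E\in\mathbb{R}$ let $$M^E(\omega)=\begin{pmatrix}E-f(T\omega)&-1\\1&0\end{pmatrix},\qquad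 \gamma(E)=\Lambda(M^E).$$ Then there is a set $\Sigma\subset\mathbb{R}$ with $\sigma(H_\omega)=\Sigma$ for all $\omega\in\Omega$, and the following hold. 1. $\mathbb{R}\setminus\Sigma$ is open, and for every $E\in\mathbb{R}\setminus\Sigma$ the function $M^E$ is uniform and $\gamma(E)>0$. 2. Conversely, if $I\subset\mathbb{R}$ is open and for every $E\in I$ the function $M^E$ is uniform and $\gamma(E)>0$, then $I\subset\mathbb{R}\setminus\Sigma$. In other words, $\mathbb{R}\setminus\Sigma$ is the largest open subset of $\mathbb{R}$ on which $M^E$ is uniform with positive Lyapunov exponent. -/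

import Mathlib

open Filter Topology MeasureTheory
open scoped MatrixGroups

namespace ErgodicSchrodinger

/-- Strict ergodicity of a homeomorphism `T`: every (two-sided) orbit is dense, and there is exactly
one `T`-invariant Borel probability measure. -/
structure IsStrictlyErgodic {Ω : Type*} [TopologicalSpace Ω] [MeasurableSpace Ω]
    (T : Ω ≃ₜ Ω) : Prop where
  dense_orbit : ∀ ω : Ω, Dense (Set.range fun n : ℤ => (T ^ n) ω)
  existsUnique_measure :
    ∃! μ : Measure Ω, IsProbabilityMeasure μ ∧ MeasurePreserving T μ μ

/-! ### The Schrödinger operators -/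

/-- The Hilbert space `ℓ²(ℤ)` of complex sequences. -/
abbrev EllTwo : Type := lp (fun _ : ℤ => ℂ) 2

theorem two_toReal_pos : 0 < (2 : ENNReal).toReal := by norm_num

theorem memℓp_shift (k : ℤ) (u : EllTwo) :
    Memℓp (fun n : ℤ => u (n + k)) 2 :=
  (memℓp_gen_iff two_toReal_pos).2
    ((Equiv.addRight k).summable_iff.2 ((memℓp_gen_iff two_toReal_pos).1 (lp.memℓp u)))

/-- The translation `(S_k u)(n) = u(n + k)` on `ℓ²(ℤ)`. -/
noncomputable def shift (k : ℤ) : EllTwo →L[ℂ] EllTwo :=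
  LinearMap.mkContinuous
    { toFun := fun u => ⟨fun n => u (n + k), memℓp_shift k u⟩
      map_add' := fun _ _ => rfl
      map_smul' := fun _ _ => rfl }
    1
    (fun u => by
      rw [one_mul, lp.norm_eq_tsum_rpow two_toReal_pos, lp.norm_eq_tsum_rpow two_toReal_pos]
      exact le_of_eq (congrArg (fun x : ℝ => x ^ (1 / (2 : ENNReal).toReal))
        ((Equiv.addRight k).tsum_eq fun n => ‖u n‖ ^ (2 : ENNReal).toReal)))

theorem shift_apply (k : ℤ) (u : EllTwo) (n : ℤ) : shift k u n = u (n + k) := rfl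

section Cocycles

variable {Ω : Type*} [TopologicalSpace Ω]

/-- Multiplication by the potential `n ↦ f (T ^ n ω)` on `ℓ²(ℤ)`. -/
noncomputable def potential [CompactSpace Ω] (T : Ω ≃ₜ Ω) (f : C(Ω, ℝ)) (ω : Ω) :
    EllTwo →L[ℂ] EllTwo :=
  lp.mapCLM 2 (fun n : ℤ => (f ((T ^ n) ω) : ℂ) • ContinuousLinearMap.id ℂ ℂ)
    (norm_nonneg f) (fun n => by
      rw [norm_smul, ContinuousLinearMap.norm_id, mul_one, Complex.norm_real]
      exact f.norm_coe_le_norm _)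

/-- The operator `(H_ω u)(n) = u(n + 1) + u(n - 1) + f(Tⁿ ω) u(n)` on `ℓ²(ℤ)`. -/
noncomputable def schrodinger [CompactSpace Ω] (T : Ω ≃ₜ Ω) (f : C(Ω, ℝ)) (ω : Ω) :
    EllTwo →L[ℂ] EllTwo :=
  shift 1 + shift (-1) + potential T f ω

theorem schrodinger_apply [CompactSpace Ω] (T : Ω ≃ₜ Ω) (f : C(Ω, ℝ)) (ω : Ω)
    (u : EllTwo) (n : ℤ) :
    schrodinger T f ω u n = u (n + 1) + u (n - 1) + (f ((T ^ n) ω) : ℂ) * u n := rfl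

/-! ### Cocycles and the Lyapunov exponent -/

/-- The product `A(T^{n-1} ω) ⋯ A(ω)` for `n ≥ 0`. -/
def cocyclePos {G : Type*} [Group G] (T : Ω ≃ₜ Ω) (A : Ω → G) : ℕ → Ω → G
  | 0, _ => 1
  | n + 1, ω => A ((T ^ (n : ℤ)) ω) * cocyclePos T A n ω

/-- The product `A⁻¹(T^{-n} ω) ⋯ A⁻¹(T^{-1} ω)` for `n ≥ 0`. -/
def cocycleNeg {G : Type*} [Group G] (T : Ω ≃ₜ Ω) (A : Ω → G) : ℕ → Ω → G
  | 0, _ => 1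
  | n + 1, ω => (A ((T ^ (-((n : ℤ) + 1))) ω))⁻¹ * cocycleNeg T A n ω

/-- The cocycle `A(n, ω)`, `n ∈ ℤ`, over `T` generated by `A`; here `Int.negSucc n = -(n + 1)`. -/
def cocycle {G : Type*} [Group G] (T : Ω ≃ₜ Ω) (A : Ω → G) : ℤ → Ω → G
  | Int.ofNat n => cocyclePos T A n
  | Int.negSucc n => cocycleNeg T A (n + 1)

/-- The operator norm of a real `2 × 2` matrix acting on the Euclidean plane. -/
noncomputable def opNorm (M : Matrix (Fin 2) (Fin 2) ℝ) : ℝ :=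
  ‖Matrix.toEuclideanCLM (n := Fin 2) (𝕜 := ℝ) M‖

/-- The averages `|n|⁻¹ log ‖A(n, ω)‖`. -/
noncomputable def growthRate (T : Ω ≃ₜ Ω) (A : C(Ω, GL (Fin 2) ℝ)) (n : ℤ) (ω : Ω) : ℝ :=
  1 / (|n| : ℝ) * Real.log (opNorm (cocycle T A n ω : GL (Fin 2) ℝ))

/-- The filter describing `|n| → ∞` for integers `n`. -/
noncomputable def absAtTop : Filter ℤ := comap (fun n : ℤ => |n|) atTop

open Classical in
/-- `Λ(A)`: the number to which `|n|⁻¹ log ‖A(n, ω)‖` converges as `|n| → ∞` for `μ`-almost every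
`ω`. It is unique when it exists; the value `0` is assigned if there is none, which does not happen
if `μ` is the invariant probability measure of a uniquely ergodic system. -/
noncomputable def Lam [MeasurableSpace Ω] (μ : Measure Ω) (T : Ω ≃ₜ Ω)
    (A : C(Ω, GL (Fin 2) ℝ)) : ℝ :=
  if h : ∃ L : ℝ, ∀ᵐ ω ∂μ, Tendsto (fun n => growthRate T A n ω) absAtTop (𝓝 L) then h.choose
  else 0

/-- `A` is uniform: `|n|⁻¹ log ‖A(n, ω)‖` converges to `Λ(A)` as `|n| → ∞` for all `ω`,
uniformly in `ω`. -/
def IsUniform [MeasurableSpace Ω] (μ : Measure Ω) (T : Ω ≃ₜ Ω)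
    (A : C(Ω, GL (Fin 2) ℝ)) : Prop :=
  TendstoUniformly (growthRate T A) (fun _ => Lam μ T A) absAtTop

/-- `Λ(A)` is the almost sure limit as soon as there is one. -/
theorem Lam_eq [MeasurableSpace Ω] {μ : Measure Ω} [NeZero μ] {T : Ω ≃ₜ Ω}
    {A : C(Ω, GL (Fin 2) ℝ)} {L : ℝ}
    (h : ∀ᵐ ω ∂μ, Tendsto (fun n => growthRate T A n ω) absAtTop (𝓝 L)) : Lam μ T A = L := by
  have hex : ∃ L : ℝ, ∀ᵐ ω ∂μ, Tendsto (fun n => growthRate T A n ω) absAtTop (𝓝 L) := ⟨L, h⟩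
  have : NeBot absAtTop := by
    refine comap_neBot fun s hs => ?_
    obtain ⟨a, ha⟩ := mem_atTop_sets.1 hs
    exact ⟨a, ha _ (le_abs_self a)⟩
  obtain ⟨ω, h1, h2⟩ := (hex.choose_spec.and h).exists
  rw [Lam, dif_pos hex]
  exact tendsto_nhds_unique h1 h2

/-- The transfer matrix at energy `E` with potential value `x`, an element of `SL(2, ℝ)`. -/
def transferSL (E x : ℝ) : SL(2, ℝ) :=
  ⟨!![E - x, -1; 1, 0], by simp [Matrix.det_fin_two]⟩

/-- The continuous function `M^E(ω) = (E - f(Tω), -1; 1, 0)`, with values in `SL(2, ℝ)`, regarded as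
a subgroup of `GL(2, ℝ)`. -/
noncomputable def transfer (T : Ω ≃ₜ Ω) (f : C(Ω, ℝ)) (E : ℝ) : C(Ω, GL (Fin 2) ℝ) where
  toFun ω := Matrix.SpecialLinearGroup.toGL (transferSL E (f (T ω)))
  continuous_toFun := by
    refine Matrix.SpecialLinearGroup.continuous_toGL.comp (continuous_induced_rng.2 ?_)
    refine continuous_matrix fun i j => ?_
    fin_cases i <;> fin_cases j <;> simp [transferSL] <;> fun_prop

/-- The Lyapunov exponent `γ(E) = Λ(M^E)`. -/
noncomputable def lyapunov [MeasurableSpace Ω] (μ : Measure Ω) (T : Ω ≃ₜ Ω) (f : C(Ω, ℝ))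
    (E : ℝ) : ℝ :=
  Lam μ T (transfer T f E)

end Cocycles

end ErgodicSchrodinger

/-! The bridge between spectrum and growth is the bound `c‖u‖ ≤ ‖(H_ω - E)u‖`, with one `c` for all
`ω` (`IsResolventPoint`). As `H_ω` is self-adjoint, this bound means that `E` is in every resolvent
set. Covariance under shifts and density of orbits carry it from one `ω` to all of them, so the
spectrum is constant (`spectrum_schrodinger_eq`).

Resolvent point ⇒ uniform and positive. `H_ω - E` maps a solution cut off to an interval to four
boundary masses, so the bound controls its interior by its boundary (`norm_le_sum_norm_boundary`).
Iteration gives exponential decay away from the boundary (`le_pow_mul_of_sum_le`), hence exponential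
growth of the propagators, and makes the direction contracted in the future transverse to the one
expanded in the past. Therefore `‖B‖‖C‖ ≤ R‖BC‖` for consecutive blocks (`exists_norm_mul_norm_le`),
the logarithms of the norms are almost additive, and unique ergodicity makes their averages converge
uniformly (`exists_tendstoUniformly_of_almostAdditive`).

Uniform and positive ⇒ resolvent point. If `‖BC‖` is nearly `‖B‖‖C‖` everywhere, plane geometry
shows that a vector is small compared with its image `N` steps ahead or `N` steps back
(`exists_norm_propagator_le_eighth`). For an `ℓ²` sequence the same inequality holds up to the
residual `(H_ω - E)φ`. Squaring and summing over `ℤ` absorbs the main terms and returns the bound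
(`exists_tsum_sq_le`). -/

namespace ErgodicSchrodinger

/-! ### Uniform ergodic theorems under unique ergodicity. -/

section UniqueErgodicity

/-- The empirical measure `n⁻¹ (δ_ω + ⋯ + δ_{T^{n-1} ω})`. -/
noncomputable def empirical {Ω : Type*} [MeasurableSpace Ω] (T : Ω → Ω) (n : ℕ) (ω : Ω) :
    Measure Ω :=
  (n : ENNReal)⁻¹ • ∑ i ∈ Finset.range n, Measure.dirac (T^[i] ω)

theorem isProbabilityMeasure_empirical {Ω : Type*} [MeasurableSpace Ω] (T : Ω → Ω) {n : ℕ}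
    (hn : n ≠ 0) (ω : Ω) : IsProbabilityMeasure (empirical T n ω) := by
  constructor
  simp [empirical, ENNReal.inv_mul_cancel (Nat.cast_ne_zero.2 hn) (ENNReal.natCast_ne_top n)]

variable {Ω : Type*} [MetricSpace Ω] [CompactSpace Ω] [MeasurableSpace Ω] [BorelSpace Ω]

theorem integral_empirical (T : Ω → Ω) (n : ℕ) (ω : Ω) {g : Ω → ℝ} (hg : Continuous g) :
    ∫ x, g x ∂(empirical T n ω) = birkhoffAverage ℝ T g n ω := by
  rw [empirical, integral_smul_measure, integral_finsetSum_measure]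
  · simp [birkhoffAverage, birkhoffSum]
  · intro i _
    exact hg.integrable_of_hasCompactSupport (HasCompactSupport.of_compactSpace g)

/-- If uniformity failed, there would be times tending to infinity and points with averages `ε` away
from the integral. A weak limit of their empirical measures is invariant, since the averages of `h ∘
T` and `h` differ by two boundary terms over `n`. It is therefore `μ`, a contradiction. -/
theorem tendstoUniformly_birkhoffAverage {T : Ω → Ω} (hT : Continuous T) {μ : Measure Ω}
    (hμ : ∀ ν : Measure Ω, IsProbabilityMeasure ν → MeasurePreserving T ν ν → ν = μ)
    {g : Ω → ℝ} (hg : Continuous g) :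
    TendstoUniformly (birkhoffAverage ℝ T g) (fun _ => ∫ x, g x ∂μ) atTop := by
  by_contra hcon
  rw [Metric.tendstoUniformly_iff] at hcon
  push Not at hcon
  obtain ⟨ε, hε, hfreq⟩ := hcon
  obtain ⟨φ, hφ, hφ'⟩ := extraction_of_frequently_atTop
    (hfreq.and_eventually (eventually_ne_atTop 0))
  choose w hw using fun k => (hφ' k).1
  let ν : ℕ → ProbabilityMeasure Ω := fun k =>
    ⟨empirical T (φ k) (w k), isProbabilityMeasure_empirical T (hφ' k).2 (w k)⟩
  obtain ⟨ρ, -, hρ⟩ := isCompact_univ.ultrafilter_le_nhds ((hyperfilter ℕ).map ν) (by simp)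
  have hlim : Tendsto ν (hyperfilter ℕ) (𝓝 ρ) := hρ
  have hint : ∀ {h : Ω → ℝ}, Continuous h → Tendsto
      (fun k => birkhoffAverage ℝ T h (φ k) (w k)) (hyperfilter ℕ) (𝓝 (∫ x, h x ∂(ρ : Measure Ω))) := by
    intro h hh
    have := ProbabilityMeasure.tendsto_iff_forall_integral_tendsto.1 hlim
      (BoundedContinuousFunction.mkOfCompact ⟨h, hh⟩)
    refine this.congr fun k => ?_
    exact integral_empirical T (φ k) (w k) hh
  have hinv : MeasurePreserving T (ρ : Measure Ω) (ρ : Measure Ω) := by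
    refine ⟨hT.measurable, ?_⟩
    have : IsProbabilityMeasure ((ρ : Measure Ω).map T) :=
      Measure.isProbabilityMeasure_map hT.aemeasurable
    refine ext_of_forall_integral_eq_of_IsFiniteMeasure fun h => ?_
    rw [integral_map hT.aemeasurable h.continuous.aestronglyMeasurable]
    refine tendsto_nhds_unique (hint (h.continuous.comp hT)) ?_
    have h0 : Tendsto (fun k => birkhoffAverage ℝ T (h ∘ T) (φ k) (w k) -
        birkhoffAverage ℝ T h (φ k) (w k)) (hyperfilter ℕ) (𝓝 0) := by
      refine Tendsto.mono_left ?_ (Nat.hyperfilter_le_atTop)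
      have h1 : Tendsto (fun k => ((φ k : ℕ) : ℝ)⁻¹ * (2 * ‖h‖)) atTop (𝓝 0) := by
        have := (tendsto_inv_atTop_nhds_zero_nat (𝕜 := ℝ)).comp hφ.tendsto_atTop
        simpa using this.mul_const (2 * ‖h‖)
      refine squeeze_zero_norm (fun k => ?_) h1
      have h2 : birkhoffSum T (h ∘ T) (φ k) (w k) = birkhoffSum T h (φ k) (T (w k)) := by
        simp only [birkhoffSum, Function.comp, ← Function.iterate_succ_apply,
          ← Function.iterate_succ_apply']
      rw [birkhoffAverage, birkhoffAverage, ← smul_sub, h2, birkhoffSum_apply_sub_birkhoffSum,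
        norm_smul, norm_inv, Real.norm_natCast]
      gcongr
      calc _ ≤ ‖h (T^[φ k] (w k))‖ + ‖h (w k)‖ := norm_sub_le _ _
        _ ≤ ‖h‖ + ‖h‖ := add_le_add (h.norm_coe_le_norm _) (h.norm_coe_le_norm _)
        _ = _ := by ring
    have := h0.add (hint h.continuous)
    simp only [sub_add_cancel, zero_add] at this
    exact this
  have hρμ := hμ ρ inferInstance hinv
  have := (hint hg).dist (tendsto_const_nhds (x := ∫ x, g x ∂μ))
  rw [hρμ, dist_self] at this
  have := ge_of_tendsto this (Eventually.of_forall fun k => by rw [dist_comm]; exact hw k)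
  linarith

/-- A continuous almost additive cocycle over a uniquely ergodic system has uniformly convergent
averages. -/
theorem exists_tendstoUniformly_of_almostAdditive {T : Ω → Ω} (hT : Continuous T) {μ : Measure Ω}
    (hμ : ∀ ν : Measure Ω, IsProbabilityMeasure ν → MeasurePreserving T ν ν → ν = μ)
    {a : ℕ → Ω → ℝ} (ha : ∀ n, Continuous (a n)) {C : ℝ}
    (hC : ∀ m n ω, |a (n + m) ω - a n (T^[m] ω) - a m ω| ≤ C) :
    ∃ L : ℝ, TendstoUniformly (fun (n : ℕ) ω => (n : ℝ)⁻¹ * a n ω) (fun _ => L) atTop := by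
  -- Almost additivity gives `a N (T^i ω) ≈ a (N + i) ω - a i ω` up to `C`. The sum over `i < n`
  -- telescopes to `N` terms `a (n + j) ω - a j ω`, each within a bounded distance of `a n ω`.
  have key : ∀ N : ℕ, ∃ D : ℝ, ∀ n ω, |birkhoffSum T (a N) n ω - N * a n ω| ≤ n * C + D := by
    intro N
    choose B hB using fun j => (isCompact_range (ha j)).isBounded.subset_closedBall 0
    have hB' : ∀ j ω, |a j ω| ≤ B j := fun j ω => by
      simpa using hB j (Set.mem_range_self ω)
    refine ⟨∑ j ∈ Finset.range N, (C + 2 * B j), fun n ω => ?_⟩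
    have tele : ∑ i ∈ Finset.range n, (a (N + i) ω - a i ω) =
        ∑ j ∈ Finset.range N, (a (n + j) ω - a j ω) := by
      have h1 := Finset.sum_range_add (fun i => a i ω) N n
      have h2 := Finset.sum_range_add (fun i => a i ω) n N
      rw [add_comm N n] at h1
      simp only [Finset.sum_sub_distrib]
      linarith
    have e1 : |∑ i ∈ Finset.range n, (a (N + i) ω - a N (T^[i] ω) - a i ω)| ≤ n * C := by
      refine (Finset.abs_sum_le_sum_abs _ _).trans ?_
      refine (Finset.sum_le_sum fun i _ => hC i N ω).trans ?_
      simp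
    have e2 : |∑ j ∈ Finset.range N, ((a (n + j) ω - a j ω) - a n ω)| ≤
        ∑ j ∈ Finset.range N, (C + 2 * B j) := by
      refine (Finset.abs_sum_le_sum_abs _ _).trans (Finset.sum_le_sum fun j _ => ?_)
      have := hC n j ω
      rw [add_comm j n] at this
      have h3 := hB' j ω
      have h4 := hB' j (T^[n] ω)
      rw [abs_le] at *
      constructor <;> linarith
    have : birkhoffSum T (a N) n ω - N * a n ω =
        ∑ j ∈ Finset.range N, ((a (n + j) ω - a j ω) - a n ω) -
          ∑ i ∈ Finset.range n, (a (N + i) ω - a N (T^[i] ω) - a i ω) := by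
      have h5 : ∑ i ∈ Finset.range n, (a (N + i) ω - a N (T^[i] ω) - a i ω) =
          ∑ i ∈ Finset.range n, (a (N + i) ω - a i ω) - birkhoffSum T (a N) n ω := by
        rw [birkhoffSum, ← Finset.sum_sub_distrib]
        exact Finset.sum_congr rfl fun i _ => by ring
      rw [h5, tele, Finset.sum_sub_distrib (f := fun j => a (n + j) ω - a j ω)]
      simp
    rw [this]
    refine (abs_sub _ _).trans ?_
    linarith
  have near : ∀ N : ℕ, 0 < N → ∀ ε > 0, ∀ᶠ n : ℕ in atTop, ∀ ω,
      |(n : ℝ)⁻¹ * a n ω - (N : ℝ)⁻¹ * ∫ x, a N x ∂μ| ≤ C / N + ε := by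
    intro N hN ε hε
    obtain ⟨D, hD⟩ := key N
    have hbirk := Metric.tendstoUniformly_iff.1
      (tendstoUniformly_birkhoffAverage hT hμ (ha N)) (ε / 2) (by positivity)
    have hDn : Tendsto (fun n : ℕ => D / n) atTop (𝓝 0) := tendsto_const_div_atTop_nhds_zero_nat D
    filter_upwards [hbirk, hDn.eventually_lt_const (half_pos hε), eventually_gt_atTop 0]
      with n h1 h2 h3 ω
    have hN' : (1 : ℝ) ≤ N := by exact_mod_cast hN
    have hn' : (0 : ℝ) < n := by exact_mod_cast h3
    have h4 := h1 ω
    rw [Real.dist_eq] at h4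
    have h5 := hD n ω
    set I := ∫ x, a N x ∂μ
    have e : (n : ℝ)⁻¹ * a n ω - (N : ℝ)⁻¹ * I =
        -((N : ℝ)⁻¹ * (I - birkhoffAverage ℝ T (a N) n ω)) -
        ((N : ℝ)⁻¹ * (n : ℝ)⁻¹) * (birkhoffSum T (a N) n ω - N * a n ω) := by
      rw [birkhoffAverage, smul_eq_mul]
      field_simp
      ring
    have hNi : (N : ℝ)⁻¹ ≤ 1 := inv_le_one_of_one_le₀ hN'
    have hNi0 : (0 : ℝ) < (N : ℝ)⁻¹ := by positivity
    rw [e]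
    refine (abs_sub _ _).trans ?_
    rw [abs_neg, abs_mul, abs_mul, abs_of_pos hNi0,
      abs_of_pos (by positivity : (0 : ℝ) < (N : ℝ)⁻¹ * (n : ℝ)⁻¹)]
    have h6 : (N : ℝ)⁻¹ * |I - birkhoffAverage ℝ T (a N) n ω| ≤ ε / 2 :=
      (mul_le_of_le_one_left (abs_nonneg _) hNi).trans h4.le
    have h7 : ((N : ℝ)⁻¹ * (n : ℝ)⁻¹) * |birkhoffSum T (a N) n ω - N * a n ω| ≤
        C / N + (N : ℝ)⁻¹ * (D / n) := by
      refine (mul_le_mul_of_nonneg_left h5 (by positivity)).trans (le_of_eq ?_)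
      field_simp
    have h8 : (N : ℝ)⁻¹ * (D / n) ≤ ε / 2 := by
      refine (mul_le_mul_of_nonneg_left h2.le hNi0.le).trans ?_
      exact mul_le_of_le_one_left (by positivity) hNi
    linarith
  rcases isEmpty_or_nonempty Ω with hΩ | ⟨⟨ω₀⟩⟩
  · exact ⟨0, Metric.tendstoUniformly_iff.2 fun ε _ => Eventually.of_forall fun _ ω => hΩ.elim ω⟩
  have hC0 : 0 ≤ C := (abs_nonneg _).trans (hC 0 0 ω₀)
  -- By `near`, the averages cluster within about `C / N` of a centre independent of `ω`. Large `N`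
  -- yields the Cauchy property at one point, and the common centre then yields uniformity.
  have hcau : CauchySeq fun n : ℕ => (n : ℝ)⁻¹ * a n ω₀ := by
    refine Metric.cauchySeq_iff'.2 fun ε hε => ?_
    obtain ⟨N, hN⟩ := exists_nat_gt (C / (ε / 8))
    have hN0 : (0 : ℝ) < N := (div_nonneg hC0 (by positivity)).trans_lt hN
    have hCN : C / N < ε / 8 := by rw [div_lt_iff₀ (by positivity)] at hN ⊢; linarith
    obtain ⟨M, hM⟩ := eventually_atTop.1 (near N (by exact_mod_cast hN0) (ε / 8) (by positivity))
    refine ⟨M, fun n hn => ?_⟩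
    have h1 := hM n hn ω₀
    have h2 := hM M le_rfl ω₀
    rw [Real.dist_eq]
    rw [abs_le] at h1 h2
    rw [abs_lt]
    constructor <;> linarith
  obtain ⟨L, hL⟩ := cauchySeq_tendsto_of_complete hcau
  refine ⟨L, Metric.tendstoUniformly_iff.2 fun ε hε => ?_⟩
  obtain ⟨N, hN⟩ := exists_nat_gt (C / (ε / 8))
  have hN0 : (0 : ℝ) < N := (div_nonneg hC0 (by positivity)).trans_lt hN
  have hCN : C / N < ε / 8 := by rw [div_lt_iff₀ (by positivity)] at hN ⊢; linarith
  have hev := near N (by exact_mod_cast hN0) (ε / 8) (by positivity)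
  have hlim : |L - (N : ℝ)⁻¹ * ∫ x, a N x ∂μ| ≤ C / N + ε / 8 :=
    le_of_tendsto (hL.sub_const _).abs (hev.mono fun n h => h ω₀)
  filter_upwards [hev] with n hn ω
  have h1 := hn ω
  rw [Real.dist_eq]
  rw [abs_le] at h1 hlim
  rw [abs_lt]
  constructor <;> linarith

end UniqueErgodicity

/-! ### Area-preserving maps of the plane. -/

section Plane

local notation "E2" => EuclideanSpace ℝ (Fin 2)

/-- The oriented area spanned by two vectors of the plane. -/
def area (x y : E2) : ℝ := x 0 * y 1 - x 1 * y 0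

/-- The rotation by a right angle. -/
noncomputable def rot (x : E2) : E2 := !₂[-x 1, x 0]

/-- A linear map of the plane that preserves oriented area. -/
def AreaPreserving (L : E2 →L[ℝ] E2) : Prop := ∀ x y, area (L x) (L y) = area x y

theorem norm_sq_eq_coords (x : E2) : ‖x‖ ^ 2 = x 0 ^ 2 + x 1 ^ 2 := by
  simp [EuclideanSpace.norm_sq_eq]

theorem norm_rot (x : E2) : ‖rot x‖ = ‖x‖ := by
  rw [← sq_eq_sq₀ (norm_nonneg _) (norm_nonneg _), norm_sq_eq_coords, norm_sq_eq_coords]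
  simp [rot]
  ring

theorem area_rot_self (x : E2) : area x (rot x) = ‖x‖ ^ 2 := by
  rw [norm_sq_eq_coords]
  simp [area, rot]
  ring

theorem inner_sq_add_area_sq (x y : E2) :
    (x 0 * y 0 + x 1 * y 1) ^ 2 + area x y ^ 2 = (‖x‖ * ‖y‖) ^ 2 := by
  rw [mul_pow, norm_sq_eq_coords, norm_sq_eq_coords, area]
  ring

theorem abs_area_le (x y : E2) : |area x y| ≤ ‖x‖ * ‖y‖ := by
  refine abs_le_of_sq_le_sq ?_ (by positivity)
  nlinarith [inner_sq_add_area_sq x y, sq_nonneg (x 0 * y 0 + x 1 * y 1)]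

theorem abs_inner_coords_le (x y : E2) : |x 0 * y 0 + x 1 * y 1| ≤ ‖x‖ * ‖y‖ := by
  refine abs_le_of_sq_le_sq ?_ (by positivity)
  nlinarith [inner_sq_add_area_sq x y, sq_nonneg (area x y)]

theorem eq_smul_add_smul_rot {v : E2} (hv : ‖v‖ = 1) (x : E2) :
    x = (v 0 * x 0 + v 1 * x 1) • v + area v x • rot v := by
  have h := norm_sq_eq_coords v
  rw [hv, one_pow] at h
  ext i
  fin_cases i <;> simp [area, rot]
  · linear_combination (x 0) * h
  · linear_combination (x 1) * h

/-- Bound for the image of `x` in terms of its component along a unit vector `v`. -/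
theorem norm_apply_le_add_area (L : E2 →L[ℝ] E2) {v : E2} (hv : ‖v‖ = 1) (x : E2) :
    ‖L x‖ ≤ ‖x‖ * ‖L v‖ + |area v x| * ‖L‖ := by
  conv_lhs => rw [eq_smul_add_smul_rot hv x]
  rw [map_add, map_smul, map_smul]
  refine (norm_add_le _ _).trans ?_
  rw [norm_smul, norm_smul, Real.norm_eq_abs, Real.norm_eq_abs]
  have h1 := abs_inner_coords_le v x
  rw [hv, one_mul] at h1
  have h2 := L.le_opNorm (rot v)
  rw [norm_rot, hv, mul_one] at h2
  gcongr

/-- Cramer's rule. -/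
theorem area_smul_eq (v w x : E2) : area v w • x = area x w • v - area x v • w := by
  ext i
  fin_cases i <;> simp [area] <;> ring

theorem exists_norm_apply_eq (L : E2 →L[ℝ] E2) : ∃ e : E2, ‖e‖ = 1 ∧ ‖L e‖ = ‖L‖ := by
  obtain ⟨e, he, hmax⟩ := (isCompact_sphere (0 : E2) 1).exists_isMaxOn
    ⟨EuclideanSpace.single 0 1, by simp⟩ (L.continuous.norm.continuousOn)
  have he1 : ‖e‖ = 1 := by simpa using he
  refine ⟨e, he1, le_antisymm (by simpa [he1] using L.le_opNorm e) ?_⟩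
  refine L.opNorm_le_of_unit_norm (norm_nonneg _) fun x hx => hmax (by simpa using hx)

theorem AreaPreserving.one_le_norm {L : E2 →L[ℝ] E2} (hL : AreaPreserving L) : 1 ≤ ‖L‖ := by
  let e : E2 := EuclideanSpace.single 0 1
  have he : ‖e‖ = 1 := by simp [e]
  have h1 := hL e (rot e)
  rw [area_rot_self, he, one_pow] at h1
  have h2 := (le_abs_self _).trans (abs_area_le (L e) (L (rot e)))
  have h3 := L.le_opNorm e
  have h4 := L.le_opNorm (rot e)
  rw [norm_rot, he, mul_one] at h4
  rw [he, mul_one] at h3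
  by_contra! h
  nlinarith [norm_nonneg (L e), norm_nonneg (L (rot e)), norm_nonneg L]

/-- `x` and its rotation span area `‖x‖²`, and so do their images, so `L x` cannot be too short.
Equivalently, `‖L⁻¹‖ ≤ ‖L‖`. -/
theorem AreaPreserving.norm_le {L : E2 →L[ℝ] E2} (hL : AreaPreserving L) (x : E2) :
    ‖x‖ ≤ ‖L‖ * ‖L x‖ := by
  rcases eq_or_ne x 0 with rfl | hx
  · simp
  have hx' : 0 < ‖x‖ := norm_pos_iff.2 hx
  have h1 := hL x (rot x)
  rw [area_rot_self] at h1
  have h2 := (le_abs_self _).trans (abs_area_le (L x) (L (rot x)))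
  have h4 := L.le_opNorm (rot x)
  rw [norm_rot] at h4
  have : ‖x‖ * ‖x‖ ≤ (‖L‖ * ‖L x‖) * ‖x‖ := by
    nlinarith [norm_nonneg (L x)]
  exact le_of_mul_le_mul_right this hx'

theorem AreaPreserving.surjective {L : E2 →L[ℝ] E2} (hL : AreaPreserving L) :
    Function.Surjective L := by
  have hinj : Function.Injective (L : E2 →ₗ[ℝ] E2) := by
    refine (injective_iff_map_eq_zero _).2 fun x hx => ?_
    have hx' : L x = 0 := hx
    have := hL.norm_le x
    rw [hx', norm_zero, mul_zero] at this
    exact norm_le_zero_iff.1 this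
  exact LinearMap.injective_iff_surjective.1 hinj

/-- The most contracted direction. -/
theorem AreaPreserving.exists_contracted {L : E2 →L[ℝ] E2} (hL : AreaPreserving L) :
    ∃ v : E2, ‖v‖ = 1 ∧ ‖L‖ * ‖L v‖ ≤ 1 := by
  obtain ⟨v, hv, hmin⟩ := (isCompact_sphere (0 : E2) 1).exists_isMinOn
    ⟨EuclideanSpace.single 0 1, by simp⟩ (L.continuous.norm.continuousOn)
  have hv1 : ‖v‖ = 1 := by simpa using hv
  refine ⟨v, hv1, ?_⟩
  have hlow : ∀ x, ‖L v‖ * ‖x‖ ≤ ‖L x‖ := by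
    intro x
    rcases eq_or_ne x 0 with rfl | hx
    · simp
    have hx' : 0 < ‖x‖ := norm_pos_iff.2 hx
    have h1 : ‖L v‖ ≤ ‖L (‖x‖⁻¹ • x)‖ := hmin (by simp [norm_smul, hx'.ne'])
    rw [map_smul, norm_smul, norm_inv, norm_norm, inv_mul_eq_div, le_div_iff₀ hx'] at h1
    exact h1
  have hvpos : 0 < ‖L v‖ := by
    have := hL.norm_le v
    by_contra! h
    nlinarith [norm_nonneg L]
  rw [← le_div_iff₀ hvpos]
  refine L.opNorm_le_bound (by positivity) fun x => ?_
  rcases eq_or_lt_of_le (norm_nonneg (L x)) with h0 | hpos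
  · rw [← h0]; positivity
  -- Now `‖L x‖² = area x z ≤ ‖x‖‖z‖`, while minimality of `v` gives `‖L v‖‖z‖ ≤ ‖L z‖ = ‖L x‖`.
  obtain ⟨z, hz⟩ := hL.surjective (rot (L x))
  have h1 := hL x z
  rw [hz, area_rot_self] at h1
  have h2 := (le_abs_self _).trans (abs_area_le x z)
  have h3 := hlow z
  rw [hz, norm_rot] at h3
  rw [div_mul_eq_mul_div, one_mul, le_div_iff₀ hvpos]
  have : ‖L x‖ * (‖L x‖ * ‖L v‖) ≤ ‖L x‖ * ‖x‖ := by
    nlinarith [norm_nonneg x]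
  exact le_of_mul_le_mul_left this hpos

/-- Any component transverse to a contracted direction is stretched by the full norm, because `L v`
is short and the area is kept. -/
theorem AreaPreserving.abs_area_mul_le {L : E2 →L[ℝ] E2} (hL : AreaPreserving L) {v : E2}
    (hv : ‖L‖ * ‖L v‖ ≤ 1) (x : E2) : |area v x| * ‖L‖ ≤ ‖L x‖ := by
  rw [← hL v x]
  have h := abs_area_le (L v) (L x)
  nlinarith [norm_nonneg (L x), norm_nonneg L]

theorem area_comm (x y : E2) : area x y = -area y x := by
  simp [area]; ring

/-- If the norm of a product is close to the product of the norms, every vector is expanded by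
one of `B`, `C⁻¹`. -/
theorem norm_apply_le_of_product {B C : E2 →L[ℝ] E2} (hB : AreaPreserving B)
    (hC : AreaPreserving C) (y : E2) :
    (‖B ∘L C‖ - ‖C‖ / ‖B‖ - ‖B‖ / ‖C‖) * ‖C y‖ ≤ ‖C‖ * ‖B (C y)‖ + ‖B‖ * ‖y‖ := by
  obtain ⟨v, hv, hBv⟩ := hB.exists_contracted
  obtain ⟨e, he, hCe⟩ := exists_norm_apply_eq C
  have hB0 : 0 < ‖B‖ := zero_lt_one.trans_le hB.one_le_norm
  have hC0 : 0 < ‖C‖ := zero_lt_one.trans_le hC.one_le_norm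
  set w : E2 := ‖C‖⁻¹ • C e with hw
  have hw1 : ‖w‖ = 1 := by rw [hw, norm_smul, norm_inv, norm_norm, hCe, inv_mul_cancel₀ hC0.ne']
  -- `w` is the image of the most expanded direction: all images under `C` lie close to its line.
  have hwC : ∀ x, |area w (C x)| ≤ ‖x‖ / ‖C‖ := by
    intro x
    have h1 : area w (C x) = ‖C‖⁻¹ * area e x := by
      rw [← hC e x, hw]; simp [area]; ring
    rw [h1, abs_mul, abs_of_pos (inv_pos.2 hC0), inv_mul_eq_div]
    have := abs_area_le e x
    rw [he, one_mul] at this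
    gcongr
  have hBv' : ‖B v‖ ≤ 1 / ‖B‖ := by rwa [le_div_iff₀' hB0]
  have hBw : ‖B w‖ ≤ 1 / ‖B‖ + |area v w| * ‖B‖ := by
    have := norm_apply_le_add_area B hv w
    rw [hw1, one_mul] at this
    linarith
  -- A large `‖B ∘L C‖` forces a large angle between `v` and `w`. Cramer's rule in the basis `v, w`
  -- then bounds `C y`.
  have hBC : ‖B ∘L C‖ ≤ ‖C‖ / ‖B‖ + |area v w| * ‖B‖ * ‖C‖ + ‖B‖ / ‖C‖ := by
    refine ContinuousLinearMap.opNorm_le_of_unit_norm (by positivity) fun x hx => ?_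
    have h1 := norm_apply_le_add_area B hw1 (C x)
    have h2 := hwC x
    have h3 := C.le_opNorm x
    rw [hx] at h2 h3
    calc ‖B (C x)‖ ≤ ‖C x‖ * ‖B w‖ + |area w (C x)| * ‖B‖ := h1
      _ ≤ (‖C‖ * 1) * (1 / ‖B‖ + |area v w| * ‖B‖) + 1 / ‖C‖ * ‖B‖ := by gcongr
      _ = _ := by field_simp
  have hx : |area v w| * ‖C y‖ ≤ ‖y‖ / ‖C‖ + ‖B (C y)‖ / ‖B‖ := by
    rw [← Real.norm_eq_abs, ← norm_smul, area_smul_eq]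
    refine (norm_sub_le _ _).trans ?_
    rw [norm_smul, norm_smul, hv, hw1, mul_one, mul_one, Real.norm_eq_abs, Real.norm_eq_abs,
      area_comm _ w, area_comm _ v, abs_neg, abs_neg]
    refine add_le_add (hwC y) ?_
    rw [le_div_iff₀ hB0]
    exact hB.abs_area_mul_le hBv _
  calc _ ≤ (|area v w| * ‖B‖ * ‖C‖) * ‖C y‖ := by gcongr; linarith
    _ = (‖B‖ * ‖C‖) * (|area v w| * ‖C y‖) := by ring
    _ ≤ (‖B‖ * ‖C‖) * (‖y‖ / ‖C‖ + ‖B (C y)‖ / ‖B‖) := by gcongr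
    _ = _ := by field_simp; ring

/-- Lower bound for the norm of a product in terms of an angle. -/
theorem norm_mul_norm_mul_area_le {B C : E2 →L[ℝ] E2} (hB : AreaPreserving B) {v e : E2}
    (hv : ‖B‖ * ‖B v‖ ≤ 1) (he : ‖e‖ = 1) :
    ‖B‖ * |area v (C e)| ≤ ‖B ∘L C‖ := by
  have h1 := hB.abs_area_mul_le hv (C e)
  have h2 := (B ∘L C).le_opNorm e
  rw [he, mul_one] at h2
  exact (mul_comm _ _).le.trans (h1.trans h2)

end Plane

/-! ### Constancy of the spectrum and the uniform resolvent bound. -/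

section Spectrum

theorem norm_shift (k : ℤ) (u : EllTwo) : ‖shift k u‖ = ‖u‖ := by
  rw [lp.norm_eq_tsum_rpow two_toReal_pos, lp.norm_eq_tsum_rpow two_toReal_pos]
  exact congrArg (fun x : ℝ => x ^ (1 / (2 : ENNReal).toReal))
    ((Equiv.addRight k).tsum_eq fun n => ‖u n‖ ^ (2 : ENNReal).toReal)

theorem inner_shift_left (k : ℤ) (u v : EllTwo) :
    inner ℂ (shift k u) v = inner ℂ u (shift (-k) v) := by
  rw [lp.inner_eq_tsum, lp.inner_eq_tsum,
    ← (Equiv.addRight k).tsum_eq (fun n => inner ℂ (u n) ((shift (-k) v : EllTwo) n))]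
  simp [shift_apply]

theorem exists_bddBelow_of_isUnit {H : Type*} [NormedAddCommGroup H] [NormedSpace ℂ H]
    {A : H →L[ℂ] H} (hA : IsUnit A) : ∃ c > 0, ∀ u, c * ‖u‖ ≤ ‖A u‖ := by
  obtain ⟨B, rfl⟩ := hA
  set R : H →L[ℂ] H := ((B⁻¹ : (H →L[ℂ] H)ˣ) : H →L[ℂ] H)
  refine ⟨(‖R‖ + 1)⁻¹, by positivity, fun u => ?_⟩
  have h1 : R ((B : H →L[ℂ] H) u) = u := by
    change (R * (B : H →L[ℂ] H)) u = u
    rw [Units.inv_mul]; rfl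
  have h2 := R.le_opNorm ((B : H →L[ℂ] H) u)
  rw [h1] at h2
  rw [inv_mul_le_iff₀ (by positivity)]
  nlinarith [norm_nonneg ((B : H →L[ℂ] H) u)]

/-- The orthogonal complement of the range is the kernel of the adjoint `A` itself, which the lower
bound makes trivial. The bound also makes the range closed. -/
theorem isUnit_of_bddBelow {H : Type*} [NormedAddCommGroup H] [InnerProductSpace ℂ H]
    [CompleteSpace H] {A : H →L[ℂ] H} (hA : IsSelfAdjoint A) {c : ℝ} (hc : 0 < c)
    (h : ∀ u, c * ‖u‖ ≤ ‖A u‖) : IsUnit A := by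
  rw [ContinuousLinearMap.isUnit_iff_bijective,
    ContinuousLinearMap.bijective_iff_dense_range_and_antilipschitz]
  refine ⟨?_, ⟨⟨c⁻¹, by positivity⟩, A.antilipschitz_of_bound fun u => ?_⟩⟩
  · rw [Submodule.topologicalClosure_eq_top_iff, ContinuousLinearMap.orthogonal_range,
      Submodule.eq_bot_iff, hA.adjoint_eq]
    intro x hx
    have hx' : A x = 0 := hx
    have := h x
    rw [hx', norm_zero] at this
    exact norm_le_zero_iff.1 (by nlinarith [norm_nonneg x])
  · change ‖u‖ ≤ c⁻¹ * ‖A u‖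
    rw [inv_mul_eq_div, le_div_iff₀ hc, mul_comm]
    exact h u

variable {Ω : Type*} [TopologicalSpace Ω] [CompactSpace Ω] (T : Ω ≃ₜ Ω) (f : C(Ω, ℝ))

theorem isSelfAdjoint_schrodinger (ω : Ω) : IsSelfAdjoint (schrodinger T f ω) := by
  rw [ContinuousLinearMap.isSelfAdjoint_iff_isSymmetric]
  intro u v
  change inner ℂ (shift 1 u + shift (-1) u + potential T f ω u) v =
    inner ℂ u (shift 1 v + shift (-1) v + potential T f ω v)
  have hp : inner ℂ (potential T f ω u) v = inner ℂ u (potential T f ω v) := by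
    rw [lp.inner_eq_tsum, lp.inner_eq_tsum]
    refine tsum_congr fun n => ?_
    change inner ℂ ((f ((T ^ n) ω) : ℂ) * u n) (v n) = inner ℂ (u n) ((f ((T ^ n) ω) : ℂ) * v n)
    simp only [RCLike.inner_apply, map_mul, Complex.conj_ofReal]
    ring
  simp only [inner_add_left, inner_add_right, hp, inner_shift_left, neg_neg]
  ring

/-- `E` lies in the resolvent set of all the operators `H_ω`, with a common bound. -/
def IsResolventPoint (E : ℝ) : Prop :=
  ∃ c > 0, ∀ (ω : Ω) (u : EllTwo), c * ‖u‖ ≤ ‖schrodinger T f ω u - (E : ℂ) • u‖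

theorem schrodinger_shift (k : ℤ) (ω : Ω) (u : EllTwo) :
    schrodinger T f ((T ^ k) ω) (shift k u) = shift k (schrodinger T f ω u) := by
  ext n
  rw [schrodinger_apply, shift_apply, shift_apply, shift_apply, shift_apply, schrodinger_apply,
    ← Homeomorph.mul_apply, ← zpow_add, add_right_comm n 1 k, sub_add_eq_add_sub n 1 k]

theorem isSelfAdjoint_schrodinger_sub (ω : Ω) (E : ℝ) :
    IsSelfAdjoint (schrodinger T f ω - algebraMap ℂ (EllTwo →L[ℂ] EllTwo) E) := by
  refine (isSelfAdjoint_schrodinger T f ω).sub ?_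
  exact IsSelfAdjoint.algebraMap _ (Complex.conj_ofReal E)

theorem shift_single (k n : ℤ) (a : ℂ) :
    shift k (lp.single 2 n a : EllTwo) = lp.single 2 (n - k) a := by
  ext m
  rw [shift_apply, lp.single_apply, lp.single_apply]
  by_cases h : m + k = n
  · obtain rfl : m = n - k := by lia
    simp
  · rw [Pi.single_eq_of_ne h, Pi.single_eq_of_ne (by lia)]

theorem schrodinger_single (ω : Ω) (n : ℤ) (a : ℂ) :
    schrodinger T f ω (lp.single 2 n a : EllTwo) =
      (lp.single 2 (n - 1) a + lp.single 2 (n + 1) a : EllTwo) +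
        (f ((T ^ n) ω) : ℂ) • (lp.single 2 n a : EllTwo) := by
  have h : potential T f ω (lp.single 2 n a : EllTwo) =
      (f ((T ^ n) ω) : ℂ) • (lp.single 2 n a : EllTwo) := by
    ext m
    change (f ((T ^ m) ω) : ℂ) * (lp.single 2 n a : EllTwo) m =
      (f ((T ^ n) ω) : ℂ) * (lp.single 2 n a : EllTwo) m
    rcases eq_or_ne m n with rfl | hm
    · rfl
    · rw [lp.single_apply_ne _ _ _ hm, mul_zero, mul_zero]
  rw [← h, ← sub_neg_eq_add n 1, ← shift_single, ← shift_single]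
  rfl

theorem continuous_schrodinger_single (n : ℤ) (a : ℂ) :
    Continuous fun ω => schrodinger T f ω (lp.single 2 n a : EllTwo) := by
  simp only [schrodinger_single]
  have hf : Continuous fun ω => (f ((T ^ n) ω) : ℂ) :=
    Complex.continuous_ofReal.comp (f.continuous.comp (T ^ n).continuous)
  exact continuous_const.add (hf.smul continuous_const)

variable {T f}

/-- The lower bound at `ω₀` spreads along its orbit by covariance. For finitely supported vectors it
is a closed condition on `ω`, since only finitely many potential values enter, so it holds on all of
`Ω`. Density of these vectors in `ℓ²` finishes. -/
theorem isResolventPoint_of_isUnit (hT : ∀ ω : Ω, Dense (Set.range fun n : ℤ => (T ^ n) ω))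
    {ω₀ : Ω} {E : ℝ}
    (h : IsUnit (schrodinger T f ω₀ - algebraMap ℂ (EllTwo →L[ℂ] EllTwo) E)) :
    IsResolventPoint T f E := by
  obtain ⟨c, hc, hlow⟩ := exists_bddBelow_of_isUnit h
  refine ⟨c, hc, fun ω u => ?_⟩
  have hlow' : ∀ u : EllTwo, c * ‖u‖ ≤ ‖schrodinger T f ω₀ u - (E : ℂ) • u‖ := fun u => hlow u
  have horb : ∀ (k : ℤ) (u : EllTwo),
      c * ‖u‖ ≤ ‖schrodinger T f ((T ^ k) ω₀) u - (E : ℂ) • u‖ := by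
    intro k u
    have hu : u = shift k (shift (-k) u) := by
      ext n; simp [shift_apply]
    have h1 := hlow' (shift (-k) u)
    rw [norm_shift] at h1
    have h2 : schrodinger T f ((T ^ k) ω₀) u - (E : ℂ) • u =
        shift k (schrodinger T f ω₀ (shift (-k) u) - (E : ℂ) • shift (-k) u) := by
      rw [map_sub, map_smul, ← schrodinger_shift, ← hu]
    rwa [h2, norm_shift]
  have hfin : ∀ (s : Finset ℤ) (ω : Ω),
      c * ‖∑ i ∈ s, (lp.single 2 i (u i) : EllTwo)‖ ≤
        ‖schrodinger T f ω (∑ i ∈ s, (lp.single 2 i (u i) : EllTwo)) -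
          (E : ℂ) • ∑ i ∈ s, (lp.single 2 i (u i) : EllTwo)‖ := by
    intro s
    have hclosed : IsClosed {ω | c * ‖∑ i ∈ s, (lp.single 2 i (u i) : EllTwo)‖ ≤
        ‖schrodinger T f ω (∑ i ∈ s, (lp.single 2 i (u i) : EllTwo)) -
          (E : ℂ) • ∑ i ∈ s, (lp.single 2 i (u i) : EllTwo)‖} := by
      refine isClosed_le continuous_const (Continuous.norm (Continuous.sub ?_ continuous_const))
      simp only [map_sum]
      exact continuous_finsetSum _ fun i _ => continuous_schrodinger_single T f i (u i)
    intro ω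
    refine closure_minimal ?_ hclosed (hT ω₀ ω)
    rintro _ ⟨k, rfl⟩
    exact horb k _
  have hsum : Tendsto (fun s : Finset ℤ => ∑ i ∈ s, (lp.single 2 i (u i) : EllTwo)) atTop (𝓝 u) :=
    lp.hasSum_single (by norm_num) u
  refine le_of_tendsto_of_tendsto (hsum.norm.const_mul c) ?_
    (Eventually.of_forall fun s => hfin s ω)
  exact ((((schrodinger T f ω).continuous.tendsto u).comp hsum).sub (hsum.const_smul (E : ℂ))).norm

theorem IsResolventPoint.isUnit {E : ℝ} (h : IsResolventPoint T f E) (ω : Ω) :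
    IsUnit (schrodinger T f ω - algebraMap ℂ (EllTwo →L[ℂ] EllTwo) E) := by
  obtain ⟨c, hc, hlow⟩ := h
  exact isUnit_of_bddBelow (isSelfAdjoint_schrodinger_sub T f ω E) hc fun u => hlow ω u

theorem spectrum_schrodinger_eq (hT : ∀ ω : Ω, Dense (Set.range fun n : ℤ => (T ^ n) ω)) (ω : Ω) :
    spectrum ℂ (schrodinger T f ω) = Complex.ofReal '' {E | ¬ IsResolventPoint T f E} := by
  have key : ∀ E : ℝ, (E : ℂ) ∈ spectrum ℂ (schrodinger T f ω) ↔ ¬ IsResolventPoint T f E := by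
    intro E
    rw [spectrum.mem_iff, not_iff_not, ← IsUnit.neg_iff, neg_sub]
    exact ⟨isResolventPoint_of_isUnit hT, fun h => h.isUnit ω⟩
  ext z
  constructor
  · intro hz
    have hre := (isSelfAdjoint_schrodinger T f ω).mem_spectrum_eq_re hz
    rw [hre] at hz
    exact ⟨z.re, (key _).1 hz, hre.symm⟩
  · rintro ⟨E, hE, rfl⟩
    exact (key E).2 hE

theorem isOpen_isResolventPoint (hT : ∀ ω : Ω, Dense (Set.range fun n : ℤ => (T ^ n) ω))
    [Nonempty Ω] : IsOpen {E | IsResolventPoint T f E} := by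
  obtain ⟨ω⟩ := ‹Nonempty Ω›
  have h : {E | IsResolventPoint T f E} =
      (Complex.ofReal ⁻¹' spectrum ℂ (schrodinger T f ω))ᶜ := by
    rw [spectrum_schrodinger_eq hT, Set.preimage_image_eq _ Complex.ofReal_injective]
    ext; simp
  rw [h]
  exact ((spectrum.isClosed _).preimage Complex.continuous_ofReal).isOpen_compl

end Spectrum

/-! ### Transfer matrices and solutions of the eigenvalue equation. -/

section Propagator

local notation "E2" => EuclideanSpace ℝ (Fin 2)

theorem homeomorph_zpow_natCast {Ω : Type*} [TopologicalSpace Ω] (T : Ω ≃ₜ Ω) (n : ℕ) (ω : Ω) :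
    (T ^ (n : ℤ)) ω = T^[n] ω := by
  rw [zpow_natCast]
  induction n with
  | zero => rfl
  | succ n ih => rw [pow_succ', Function.iterate_succ_apply', ← ih]; rfl

variable {Ω : Type*} [TopologicalSpace Ω] (T : Ω ≃ₜ Ω) (f : C(Ω, ℝ)) (E : ℝ)

/-- The linear map of the plane with matrix `M^E(n, ω)`, for `n ≥ 0`. -/
noncomputable def propagator (n : ℕ) (ω : Ω) : E2 →L[ℝ] E2 :=
  Matrix.toEuclideanCLM (n := Fin 2) (𝕜 := ℝ) (cocyclePos T (transfer T f E) n ω : GL (Fin 2) ℝ)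

@[simp] theorem propagator_zero (ω : Ω) (x : E2) : propagator T f E 0 ω x = x := by
  simp [propagator, cocyclePos]

/-- `transfer` evaluates `f` at `T ω`, hence the index `n + 1`. With it the vector at time `n` is
`(u (n + 1), u n)` for a solution `u` of `H_ω u = E u`. -/
theorem propagator_succ (n : ℕ) (ω : Ω) (x : E2) :
    propagator T f E (n + 1) ω x =
      Matrix.toEuclideanCLM (n := Fin 2) (𝕜 := ℝ) (transferSL E (f (T^[n + 1] ω))).1
        (propagator T f E n ω x) := by
  rw [propagator, cocyclePos, Units.val_mul, map_mul, mul_apply_eq_comp, ← propagator,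
    homeomorph_zpow_natCast, Function.iterate_succ_apply']
  rfl

theorem propagator_succ_apply_one (n : ℕ) (ω : Ω) (x : E2) :
    propagator T f E (n + 1) ω x 1 = propagator T f E n ω x 0 := by
  rw [propagator_succ]
  simp [transferSL, Matrix.mulVec, dotProduct, Fin.sum_univ_two]

theorem propagator_succ_apply_zero (n : ℕ) (ω : Ω) (x : E2) :
    propagator T f E (n + 1) ω x 0 =
      (E - f (T^[n + 1] ω)) * propagator T f E n ω x 0 - propagator T f E n ω x 1 := by
  rw [propagator_succ]
  simp [transferSL, Matrix.mulVec, dotProduct, Fin.sum_univ_two]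
  ring

theorem ext_coords {x y : E2} (h0 : x 0 = y 0) (h1 : x 1 = y 1) : x = y := by
  ext i; fin_cases i <;> assumption

theorem propagator_add (n m : ℕ) (ω : Ω) :
    propagator T f E (n + m) ω = propagator T f E n (T^[m] ω) ∘L propagator T f E m ω := by
  induction n with
  | zero => ext x : 1; simp
  | succ n ih =>
    ext x : 1
    rw [add_right_comm, propagator_succ, ih, ContinuousLinearMap.comp_apply,
      ContinuousLinearMap.comp_apply, propagator_succ, ← Function.iterate_add_apply,
      add_right_comm n 1 m]

theorem areaPreserving_propagator (n : ℕ) (ω : Ω) : AreaPreserving (propagator T f E n ω) := by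
  intro x y
  induction n with
  | zero => simp
  | succ n ih =>
    rw [← ih, area, propagator_succ_apply_one, propagator_succ_apply_one,
      propagator_succ_apply_zero, propagator_succ_apply_zero, area]
    ring

theorem continuous_propagator (n : ℕ) : Continuous (propagator T f E n) := by
  have h : Continuous fun ω => cocyclePos T (transfer T f E) n ω := by
    induction n with
    | zero => exact continuous_const
    | succ n ih =>
      exact ((transfer T f E).continuous.comp (T ^ (n : ℤ)).continuous).mul ih
  have h2 : Continuous fun M : Matrix (Fin 2) (Fin 2) ℝ =>
      Matrix.toEuclideanCLM (n := Fin 2) (𝕜 := ℝ) M :=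
    LinearMap.continuous_of_finiteDimensional
      (Matrix.toEuclideanCLM (n := Fin 2) (𝕜 := ℝ)).toAlgEquiv.toLinearMap
  exact h2.comp (Units.continuous_val.comp h)

theorem exists_norm_propagator_le [CompactSpace Ω] :
    ∃ g : ℝ, 1 ≤ g ∧ ∀ n ω, ‖propagator T f E n ω‖ ≤ g ^ n := by
  obtain ⟨g, hg⟩ := (isCompact_range (continuous_propagator T f E 1)).isBounded.exists_norm_le
  refine ⟨max g 1, le_max_right _ _, fun n ω => ?_⟩
  induction n with
  | zero =>
    refine ContinuousLinearMap.opNorm_le_bound _ (by simp) fun x => by simp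
  | succ n ih =>
    rw [add_comm n 1, propagator_add, pow_add, pow_one]
    refine (ContinuousLinearMap.opNorm_comp_le _ _).trans ?_
    gcongr
    exact (hg _ (Set.mem_range_self _)).trans (le_max_left _ _)

/-- The truncation `U n` of a solution to `[1, n]` satisfies the eigenvalue equation except at the
sites `0, 1, n, n + 1`. The factor `4` is Cauchy–Schwarz for four boundary terms. -/
theorem norm_le_sum_norm_boundary [CompactSpace Ω] {c : ℝ}
    {ω : Ω} (hc : ∀ u : EllTwo, c * ‖u‖ ≤ ‖schrodinger T f ω u - (E : ℂ) • u‖) (hc0 : 0 < c)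
    (u : ℕ → ℝ) (hu : ∀ j, u (j + 2) = (E - f (T^[j + 1] ω)) * u (j + 1) - u j) (n : ℕ) :
    c ^ 2 * ∑ i ∈ Finset.range n, u (i + 1) ^ 2 ≤
      4 * (u 1 ^ 2 + u 0 ^ 2 + u (n + 1) ^ 2 + u n ^ 2) := by
  let δ : ℤ → ℝ → EllTwo := fun m a => lp.single 2 m (a : ℂ)
  let U : ℕ → EllTwo := fun n => ∑ i ∈ Finset.range n, δ (i + 1) (u (i + 1))
  have hU : ∀ n, schrodinger T f ω (U n) - (E : ℂ) • U n =
      δ 0 (u 1) - δ 1 (u 0) - δ n (u (n + 1)) + δ (n + 1) (u n) := by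
    intro n
    induction n with
    | zero => simp [U]
    | succ n ih =>
      have h1 : U (n + 1) = U n + δ (n + 1) (u (n + 1)) := Finset.sum_range_succ _ _
      have h2 : schrodinger T f ω (δ (n + 1) (u (n + 1))) = (δ n (u (n + 1)) +
          δ (n + 2) (u (n + 1))) + (f (T^[n + 1] ω) : ℂ) • δ (n + 1) (u (n + 1)) := by
        have := schrodinger_single T f ω ((n : ℤ) + 1) (u (n + 1) : ℂ)
        rw [← homeomorph_zpow_natCast, Nat.cast_succ]
        rw [add_sub_cancel_right, add_assoc (n : ℤ) 1 1, one_add_one_eq_two] at this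
        exact this
      have h3 : (f (T^[n + 1] ω) : ℂ) • δ (n + 1) (u (n + 1)) - (E : ℂ) • δ (n + 1) (u (n + 1)) =
          - δ (n + 1) (u (n + 2)) - δ (n + 1) (u n) := by
        have e1 : ∀ (m : ℤ) (a b : ℝ), (a : ℂ) • δ m b = δ m (a * b) := fun m a b => by
          simp only [δ, ← lp.single_smul, smul_eq_mul, Complex.ofReal_mul]
        have e2 : ∀ (m : ℤ) (a b : ℝ), δ m a - δ m b = δ m (a - b) := fun m a b => by
          simp only [δ, ← lp.single_sub, Complex.ofReal_sub]
        have e3 : ∀ (m : ℤ) (a : ℝ), - δ m a = δ m (-a) := fun m a => by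
          simp only [δ, ← lp.single_neg, Complex.ofReal_neg]
        rw [e1, e1, e2, e3, e2, hu]
        congr 1; ring
      rw [h1, map_add, h2, smul_add]
      have h4 : δ ((n + 1 : ℕ) + 1) (u (n + 1)) = δ (n + 2) (u (n + 1)) := by
        congr 1
      have h5 : δ ((n + 1 : ℕ)) (u (n + 1 + 1)) = δ (n + 1) (u (n + 2)) := by
        congr 1
      rw [h4, h5]
      calc _ = (schrodinger T f ω (U n) - (E : ℂ) • U n) + δ n (u (n + 1)) + δ (n + 2) (u (n + 1)) +
            ((f (T^[n + 1] ω) : ℂ) • δ (n + 1) (u (n + 1)) -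
              (E : ℂ) • δ (n + 1) (u (n + 1))) := by abel
        _ = _ := by rw [ih, h3]; abel
  have hδ : ∀ m a, ‖δ m a‖ = |a| := fun m a => by
    simp only [δ]; rw [lp.norm_single (by norm_num), Complex.norm_real, Real.norm_eq_abs]
  have hnorm : ‖U n‖ ^ 2 = ∑ i ∈ Finset.range n, u (i + 1) ^ 2 := by
    have := lp.norm_sum_single (p := 2) two_toReal_pos (fun i : ℤ => (u i.toNat : ℂ))
      ((Finset.range n).map ⟨fun i : ℕ => (i : ℤ) + 1, fun i j h => by simpa using h⟩)
    simp only [Finset.sum_map, ENNReal.toReal_ofNat,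
      Real.rpow_ofNat, Complex.norm_real, Real.norm_eq_abs, sq_abs] at this
    exact this
  have hle : c * ‖U n‖ ≤ |u 1| + |u 0| + |u (n + 1)| + |u n| := by
    refine (hc (U n)).trans ?_
    rw [hU, ← hδ 0, ← hδ 1 (u 0), ← hδ n (u (n + 1)), ← hδ (n + 1) (u n)]
    refine (norm_add_le _ _).trans (add_le_add_left ((norm_sub_le _ _).trans
      (add_le_add_left (norm_sub_le _ _) _)) _)
  have hsq := pow_le_pow_left₀ (by positivity) hle 2
  rw [mul_pow, hnorm] at hsq
  refine hsq.trans ?_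
  rw [← sq_abs (u 1), ← sq_abs (u 0), ← sq_abs (u (n + 1)), ← sq_abs (u n)]
  nlinarith [sq_nonneg (|u 1| - |u 0|), sq_nonneg (|u 1| - |u (n + 1)|), sq_nonneg (|u 1| - |u n|),
    sq_nonneg (|u 0| - |u (n + 1)|), sq_nonneg (|u 0| - |u n|), sq_nonneg (|u (n + 1)| - |u n|)]

variable {T f E}

theorem IsResolventPoint.exists_sum_norm_sq_le [CompactSpace Ω] (h : IsResolventPoint T f E) :
    ∃ K : ℝ, 2 ≤ K ∧ ∀ ω x n, ∑ j ∈ Finset.range (n + 1), ‖propagator T f E j ω x‖ ^ 2 ≤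
      K * (‖x‖ ^ 2 + ‖propagator T f E n ω x‖ ^ 2) := by
  obtain ⟨c, hc, hlow⟩ := h
  have hpos : 0 ≤ 8 / c ^ 2 := by positivity
  -- Each interior value occurs in two consecutive vectors, which doubles `4 / c ^ 2`. The summand
  -- `2` covers the end values and keeps `K > 1`, so that the later rate `1 - 1 / K` is positive.
  refine ⟨8 / c ^ 2 + 2, by linarith, fun ω x n => ?_⟩
  set u : ℕ → ℝ := fun j => propagator T f E j ω x 1 with hu
  have hu0 : ∀ j, propagator T f E j ω x 0 = u (j + 1) := fun j =>
    (propagator_succ_apply_one T f E j ω x).symm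
  have hrec : ∀ j, u (j + 2) = (E - f (T^[j + 1] ω)) * u (j + 1) - u j := fun j => by
    rw [← hu0, ← hu0, propagator_succ_apply_zero]
  have hs : ∀ j, ‖propagator T f E j ω x‖ ^ 2 = u (j + 1) ^ 2 + u j ^ 2 := fun j => by
    rw [norm_sq_eq_coords, hu0]
  have hx : ‖x‖ ^ 2 = u 1 ^ 2 + u 0 ^ 2 := by
    have := hs 0
    rwa [propagator_zero] at this
  have hb := norm_le_sum_norm_boundary T f E (hlow ω) hc u hrec n
  rw [hx, hs n]
  simp only [hs]
  rw [Finset.sum_add_distrib, Finset.sum_range_succ, Finset.sum_range_succ' (fun j => u j ^ 2)]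
  have hb' : ∑ i ∈ Finset.range n, u (i + 1) ^ 2 ≤
      4 / c ^ 2 * (u 1 ^ 2 + u 0 ^ 2 + u (n + 1) ^ 2 + u n ^ 2) := by
    rw [div_mul_eq_mul_div, le_div_iff₀ (by positivity), mul_comm]
    exact hb
  have : 8 / c ^ 2 = 2 * (4 / c ^ 2) := by ring
  rw [this]
  nlinarith [sq_nonneg (u 0), sq_nonneg (u 1), sq_nonneg (u n), sq_nonneg (u (n + 1))]

/-- A nonnegative sequence whose sums over intervals are controlled by the boundary values decays
exponentially away from the boundary. -/
theorem le_pow_mul_of_sum_le {s : ℕ → ℝ} {K : ℝ} (hK : 1 ≤ K)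
    (h : ∀ p q, ∑ i ∈ Finset.range (q + 1), s (p + i) ≤ K * (s p + s (p + q))) (p k : ℕ) :
    s (p + k) ≤ K * (1 - 1 / K) ^ k * (s p + s (p + 2 * k)) := by
  have hK0 : 0 < K := by linarith
  have hlam : 0 ≤ 1 - 1 / K := sub_nonneg.2 ((div_le_one hK0).2 hK)
  -- The two end points carry at least the share `1 / K` of the sum, so dropping them gains a factor
  -- `1 - 1 / K`. After `k` rounds only the midpoint is left.
  have key : ∀ k p, s (p + k) ≤ (1 - 1 / K) ^ k * ∑ i ∈ Finset.range (2 * k + 1), s (p + i) := by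
    intro k
    induction k with
    | zero => intro p; simp
    | succ k ih =>
      intro p
      have h1 := ih (p + 1)
      have h2 : ∑ i ∈ Finset.range (2 * (k + 1) + 1), s (p + i) =
          s p + ∑ i ∈ Finset.range (2 * k + 1), s (p + 1 + i) + s (p + 2 * (k + 1)) := by
        rw [Finset.sum_range_succ, mul_add, mul_one, Finset.sum_range_succ']
        simp only [add_zero, add_assoc, add_comm 1]
        ring
      have h3 := h p (2 * (k + 1))
      rw [h2] at h3
      rw [h2, pow_succ, mul_assoc, ← add_assoc p k 1, add_right_comm p k 1]
      refine h1.trans (mul_le_mul_of_nonneg_left ?_ (pow_nonneg hlam k))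
      set S := ∑ i ∈ Finset.range (2 * k + 1), s (p + 1 + i)
      have h4 : (s p + S + s (p + 2 * (k + 1))) / K ≤ s p + s (p + 2 * (k + 1)) := by
        rwa [div_le_iff₀' hK0]
      have h5 : (1 - 1 / K) * (s p + S + s (p + 2 * (k + 1))) =
        (s p + S + s (p + 2 * (k + 1))) - (s p + S + s (p + 2 * (k + 1))) / K := by ring
      rw [h5]; linarith
  refine (key k p).trans ?_
  rw [mul_comm K, mul_assoc]
  exact mul_le_mul_of_nonneg_left (h p (2 * k)) (pow_nonneg hlam k)

end Propagator

/-! ### Exponential dichotomy and almost multiplicativity. -/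

section Hyperbolic

local notation "E2" => EuclideanSpace ℝ (Fin 2)

variable {Ω : Type*} [TopologicalSpace Ω] {T : Ω ≃ₜ Ω} {f : C(Ω, ℝ)} {E : ℝ}

theorem propagator_add_apply (n m : ℕ) (ω : Ω) (x : E2) :
    propagator T f E n (T^[m] ω) (propagator T f E m ω x) = propagator T f E (n + m) ω x := by
  rw [propagator_add]; rfl

theorem exists_norm_sq_propagator_le [CompactSpace Ω] (h : IsResolventPoint T f E) :
    ∃ K lam : ℝ, 1 ≤ K ∧ 0 < lam ∧ lam < 1 ∧
      (∀ ω x p q, ‖propagator T f E p ω x‖ ^ 2 ≤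
        K * (‖x‖ ^ 2 + ‖propagator T f E (q + p) ω x‖ ^ 2)) ∧
      ∀ ω x p k, ‖propagator T f E (p + k) ω x‖ ^ 2 ≤ K * lam ^ k *
        (‖propagator T f E p ω x‖ ^ 2 + ‖propagator T f E (p + 2 * k) ω x‖ ^ 2) := by
  obtain ⟨K, hK, hsum⟩ := h.exists_sum_norm_sq_le
  have hK0 : 0 < K := by linarith
  refine ⟨K, 1 - 1 / K, by linarith, sub_pos.2 ((div_lt_one hK0).2 (by linarith)),
    sub_lt_self _ (by positivity), fun ω x p q => ?_, fun ω x => ?_⟩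
  · refine le_trans ?_ (hsum ω x (q + p))
    exact Finset.single_le_sum (f := fun j => ‖propagator T f E j ω x‖ ^ 2)
      (fun i _ => sq_nonneg _) (Finset.mem_range.2 (by lia))
  · refine le_pow_mul_of_sum_le (s := fun j => ‖propagator T f E j ω x‖ ^ 2) (by linarith)
      fun p q => ?_
    have := hsum (T^[p] ω) (propagator T f E p ω x) q
    simp only [propagator_add_apply] at this
    simpa only [add_comm p] using this

/-- The vector most contracted at time `2n` has norm at most `1` at both ends, hence is
exponentially small at time `n`. Area preservation turns this into growth of the norm. -/
theorem exists_one_le_mul_norm_sq_propagator [CompactSpace Ω] (h : IsResolventPoint T f E) :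
    ∃ K lam : ℝ, 1 ≤ K ∧ 0 < lam ∧ lam < 1 ∧
      ∀ n ω, 1 ≤ K * lam ^ n * ‖propagator T f E n ω‖ ^ 2 := by
  obtain ⟨K, lam, hK, hlam, hlam1, -, hdec⟩ := exists_norm_sq_propagator_le h
  refine ⟨2 * K, lam, by linarith, hlam, hlam1, fun n ω => ?_⟩
  have harea := areaPreserving_propagator T f E (2 * n) ω
  obtain ⟨v, hv, hBv⟩ := harea.exists_contracted
  have h1 : ‖propagator T f E (2 * n) ω v‖ ≤ 1 := by
    nlinarith [harea.one_le_norm, norm_nonneg (propagator T f E (2 * n) ω v)]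
  have h2 := hdec ω v 0 n
  rw [zero_add, zero_add, propagator_zero, hv] at h2
  have h3 : ‖propagator T f E n ω v‖ ^ 2 ≤ K * lam ^ n * 2 := by
    refine h2.trans (mul_le_mul_of_nonneg_left ?_ (by positivity))
    nlinarith [norm_nonneg (propagator T f E (2 * n) ω v)]
  have h4 := (areaPreserving_propagator T f E n ω).norm_le v
  rw [hv] at h4
  have h5 : 1 ≤ ‖propagator T f E n ω‖ ^ 2 * ‖propagator T f E n ω v‖ ^ 2 := by
    rw [← mul_pow]; exact one_le_pow₀ h4
  nlinarith [sq_nonneg ‖propagator T f E n ω‖]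

/-- The direction contracted in the future is transverse to the direction expanded in the past. -/
theorem norm_sq_le_mul_area_sq {K lam G : ℝ} {N : ℕ} (hK : 1 ≤ K) (hlam : 0 < lam)
    (hbd : ∀ ω x p q, ‖propagator T f E p ω x‖ ^ 2 ≤
        K * (‖x‖ ^ 2 + ‖propagator T f E (q + p) ω x‖ ^ 2))
    (hdec : ∀ ω x p k, ‖propagator T f E (p + k) ω x‖ ^ 2 ≤ K * lam ^ k *
        (‖propagator T f E p ω x‖ ^ 2 + ‖propagator T f E (p + 2 * k) ω x‖ ^ 2))
    (hN : 9 * K ^ 3 * lam ^ N ≤ 1 / 2) (hG : ∀ ω, ‖propagator T f E N ω‖ ≤ G)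
    {n m : ℕ} {ω : Ω} {v e : E2} (hv : ‖v‖ = 1)
    (hv' : ‖propagator T f E (n + 2 * N) (T^[m + 2 * N] ω) v‖ ≤ 1) (he : ‖e‖ = 1) {c : ℝ}
    (hc : 1 ≤ c) (he' : ‖propagator T f E (m + 2 * N) ω e‖ = c) :
    c ^ 2 ≤ 4 * (K * G ^ 2) * |area v (propagator T f E (m + 2 * N) ω e)| ^ 2 := by
  -- `δ` bounds the squared size of `v` after `N` steps and, relative to `c²`, that of the orbit of
  -- `e` at `N` steps before its end. The hypothesis `hN` says `3Kδ ≤ 1/2`.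
  obtain ⟨δ, hδ⟩ : ∃ δ, δ = 3 * K ^ 2 * lam ^ N := ⟨_, rfl⟩
  have hδ0 : 0 ≤ δ := by rw [hδ]; positivity
  have hKδ : 3 * K * δ ≤ 1 / 2 := le_of_eq_of_le (by rw [hδ]; ring) hN
  have hB1 : ‖propagator T f E N (T^[m + 2 * N] ω) v‖ ^ 2 ≤ δ := by
    have h1 := hbd (T^[m + 2 * N] ω) v (2 * N) n
    have h2 := hdec (T^[m + 2 * N] ω) v 0 N
    rw [zero_add, zero_add, propagator_zero] at h2
    rw [hv] at h1 h2
    have h3 := pow_le_one₀ (n := 2) (norm_nonneg _) hv'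
    calc _ ≤ _ := h2
      _ ≤ K * lam ^ N * (1 ^ 2 + K * (1 ^ 2 + 1)) := by gcongr; exact h1.trans (by gcongr)
      _ ≤ K * lam ^ N * (3 * K) := by gcongr; linarith
      _ = δ := by rw [hδ]; ring
  have hC2 : ‖propagator T f E (m + N) ω e‖ ^ 2 ≤ δ * c ^ 2 := by
    have h1 := hbd ω e m (2 * N)
    have h2 := hdec ω e m N
    rw [he'] at h2
    rw [add_comm (2 * N), he', he] at h1
    calc _ ≤ _ := h2
      _ ≤ K * lam ^ N * (K * (c ^ 2 + c ^ 2) + K * c ^ 2) := by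
        gcongr
        · exact h1.trans (by gcongr)
        · exact le_mul_of_one_le_left (by positivity) hK
      _ = δ * c ^ 2 := by rw [hδ]; ring
  -- The orbit of `e` at time `m + 2N` is controlled by times `m + N` and `m + 3N`. The former is
  -- negligible, so the latter is not; yet it would be small if the vector were nearly parallel to
  -- `v`.
  have hmid := hbd (T^[m + N] ω) (propagator T f E (m + N) ω e) N N
  have e1 : N + (m + N) = m + 2 * N := by ring
  have e2 : N + N + (m + N) = N + (m + 2 * N) := by ring
  rw [propagator_add_apply, propagator_add_apply, e1, e2,
    ← propagator_add_apply N, he'] at hmid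
  have hup : ‖propagator T f E N (T^[m + 2 * N] ω) (propagator T f E (m + 2 * N) ω e)‖ ^ 2 ≤
      2 * (c ^ 2 * δ) + 2 * (|area v (propagator T f E (m + 2 * N) ω e)| ^ 2 * G ^ 2) := by
    have h1 := norm_apply_le_add_area (propagator T f E N (T^[m + 2 * N] ω)) hv
      (propagator T f E (m + 2 * N) ω e)
    have h2 := hG (T^[m + 2 * N] ω)
    rw [he'] at h1
    generalize |area v (propagator T f E (m + 2 * N) ω e)| = d at *
    calc _ ≤ (c * ‖propagator T f E N (T^[m + 2 * N] ω) v‖ +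
          d * ‖propagator T f E N (T^[m + 2 * N] ω)‖) ^ 2 :=
          pow_le_pow_left₀ (norm_nonneg _) h1 2
      _ ≤ 2 * ((c * ‖propagator T f E N (T^[m + 2 * N] ω) v‖) ^ 2 +
            (d * ‖propagator T f E N (T^[m + 2 * N] ω)‖) ^ 2) := add_sq_le
      _ ≤ _ := by
        rw [mul_pow, mul_pow, mul_add]
        gcongr
  generalize |area v (propagator T f E (m + 2 * N) ω e)| = d at *
  have h1 : c ^ 2 ≤ K * (δ * c ^ 2 + (2 * (c ^ 2 * δ) + 2 * (d ^ 2 * G ^ 2))) :=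
    hmid.trans (by gcongr)
  have h2 : 3 * K * δ * c ^ 2 ≤ 1 / 2 * c ^ 2 := by gcongr
  linarith

theorem AreaPreserving.norm_right_le {B C : E2 →L[ℝ] E2} (hB : AreaPreserving B) :
    ‖C‖ ≤ ‖B‖ * ‖B ∘L C‖ := by
  refine C.opNorm_le_bound (by positivity) fun x => (hB.norm_le (C x)).trans ?_
  rw [mul_assoc]
  exact mul_le_mul_of_nonneg_left ((B ∘L C).le_opNorm x) (norm_nonneg _)

theorem AreaPreserving.norm_left_le {B C : E2 →L[ℝ] E2} (hC : AreaPreserving C) :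
    ‖B‖ ≤ ‖C‖ * ‖B ∘L C‖ := by
  refine B.opNorm_le_bound (by positivity) fun y => ?_
  obtain ⟨x, rfl⟩ := hC.surjective y
  have h4 := mul_le_mul_of_nonneg_left (hC.norm_le x) (norm_nonneg (B ∘L C))
  exact ((B ∘L C).le_opNorm x).trans (h4.trans (le_of_eq (by ring)))

theorem mul_le_mul_of_sq_le {R b c d s : ℝ} (hR : 1 ≤ R) (hb : 0 ≤ b) (hd : 0 ≤ d) (hs : 0 ≤ s)
    (hc : c ^ 2 ≤ R * d ^ 2) (hbd : b * d ≤ s) : b * c ≤ R * s := by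
  refine (abs_le_of_sq_le_sq' ?_ (by positivity)).2
  calc (b * c) ^ 2 = b ^ 2 * c ^ 2 := mul_pow _ _ _
    _ ≤ b ^ 2 * (R * d ^ 2) := by gcongr
    _ = R * (b * d) ^ 2 := by ring
    _ ≤ R * s ^ 2 := by gcongr
    _ ≤ R ^ 2 * s ^ 2 := by gcongr; nlinarith
    _ = (R * s) ^ 2 := by ring

/-- Along a hyperbolic orbit the norms of the propagators are almost multiplicative. -/
theorem exists_norm_mul_norm_le [CompactSpace Ω] (h : IsResolventPoint T f E) :
    ∃ R : ℝ, 1 ≤ R ∧ ∀ m n ω, ‖propagator T f E n (T^[m] ω)‖ * ‖propagator T f E m ω‖ ≤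
      R * ‖propagator T f E (n + m) ω‖ := by
  obtain ⟨K, lam, hK, hlam, hlam1, hbd, hdec⟩ := exists_norm_sq_propagator_le h
  obtain ⟨g, hg, hgn⟩ := exists_norm_propagator_le T f E
  obtain ⟨N, hN⟩ : ∃ N : ℕ, 9 * K ^ 3 * lam ^ N ≤ 1 / 2 := by
    have := (tendsto_pow_atTop_nhds_zero_of_lt_one hlam.le hlam1).const_mul (9 * K ^ 3)
    rw [mul_zero] at this
    exact (this.eventually_le_const (by norm_num : (0 : ℝ) < 1 / 2)).exists
  obtain ⟨G, hG1, hGn⟩ : ∃ G : ℝ, 1 ≤ G ∧ ∀ n ≤ 2 * N, ∀ ω, ‖propagator T f E n ω‖ ≤ G :=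
    ⟨g ^ (2 * N), one_le_pow₀ hg, fun n hn ω =>
      (hgn n ω).trans (pow_le_pow_right₀ hg hn)⟩
  have hKG : 1 ≤ K * G ^ 2 := one_le_mul_of_one_le_of_one_le hK (one_le_pow₀ hG1)
  have hGK : G ^ 2 ≤ 4 * (K * G ^ 2) := by nlinarith [sq_nonneg G]
  refine ⟨4 * (K * G ^ 2), by linarith, fun m n ω => ?_⟩
  have hBa := areaPreserving_propagator T f E n (T^[m] ω)
  have hCa := areaPreserving_propagator T f E m ω
  rw [propagator_add]
  -- A block shorter than `2N` has norm at most `G`, and removing it from the product costs only a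
  -- factor `G`. Two long blocks need transversality.
  rcases lt_or_ge n (2 * N) with hn | hn
  · have h2 := hGn n hn.le (T^[m] ω)
    calc _ ≤ ‖propagator T f E n (T^[m] ω)‖ * _ :=
          mul_le_mul_of_nonneg_left hBa.norm_right_le (norm_nonneg _)
      _ = ‖propagator T f E n (T^[m] ω)‖ ^ 2 * _ := by rw [← mul_assoc, ← sq]
      _ ≤ _ := mul_le_mul_of_nonneg_right
        ((pow_le_pow_left₀ (norm_nonneg _) h2 2).trans hGK) (norm_nonneg _)
  rcases lt_or_ge m (2 * N) with hm | hm
  · have h2 := hGn m hm.le ω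
    calc _ ≤ _ * ‖propagator T f E m ω‖ :=
          mul_le_mul_of_nonneg_right hCa.norm_left_le (norm_nonneg _)
      _ = ‖propagator T f E m ω‖ ^ 2 * _ := by rw [mul_right_comm, ← sq]
      _ ≤ _ := mul_le_mul_of_nonneg_right
        ((pow_le_pow_left₀ (norm_nonneg _) h2 2).trans hGK) (norm_nonneg _)
  obtain ⟨n', rfl⟩ := Nat.exists_eq_add_of_le' hn
  obtain ⟨m', rfl⟩ := Nat.exists_eq_add_of_le' hm
  obtain ⟨v, hv, hBv⟩ := hBa.exists_contracted
  obtain ⟨e, he, hCe⟩ := exists_norm_apply_eq (propagator T f E (m' + 2 * N) ω)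
  have hBv1 : ‖propagator T f E (n' + 2 * N) (T^[m' + 2 * N] ω) v‖ ≤ 1 :=
    (le_mul_of_one_le_left (norm_nonneg _) hBa.one_le_norm).trans hBv
  have hang := norm_sq_le_mul_area_sq hK hlam hbd hdec hN (hGn N (by lia)) hv hBv1 he
    hCa.one_le_norm hCe
  have hfin := norm_mul_norm_mul_area_le (C := propagator T f E (m' + 2 * N) ω) hBa hBv he
  exact mul_le_mul_of_sq_le (by linarith) (norm_nonneg _) (abs_nonneg _) (norm_nonneg _) hang hfin

end Hyperbolic

/-! ### Growth rates at negative and positive times. -/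

section Growth

local notation "E2" => EuclideanSpace ℝ (Fin 2)

variable {Ω : Type*} [TopologicalSpace Ω] {T : Ω ≃ₜ Ω} {f : C(Ω, ℝ)} {E : ℝ}

theorem growthRate_natCast (n : ℕ) (ω : Ω) :
    growthRate T (transfer T f E) n ω = (n : ℝ)⁻¹ * Real.log ‖propagator T f E n ω‖ := by
  rw [growthRate, Int.cast_natCast, Nat.abs_cast, one_div]
  rfl

theorem cocycleNeg_eq {G : Type*} [Group G] (A : Ω → G) (n : ℕ) (ω : Ω) :
    cocycleNeg T A n ω = (cocyclePos T A n ((T ^ (-(n : ℤ))) ω))⁻¹ := by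
  have hshift : ∀ (n : ℕ) (ω : Ω),
      cocyclePos T A (n + 1) ω = cocyclePos T A n (T ω) * A ω := by
    intro n
    induction n with
    | zero => intro ω; simp [cocyclePos]
    | succ n ih =>
      intro ω
      rw [cocyclePos, ih, cocyclePos, mul_assoc]
      congr 2
  induction n generalizing ω with
  | zero => simp [cocycleNeg, cocyclePos]
  | succ n ih =>
    rw [cocycleNeg, hshift, mul_inv_rev, ih]
    congr 3
    rw [Nat.cast_succ, neg_add_rev, zpow_add, zpow_neg_one, ← Homeomorph.mul_apply, mul_inv_cancel_left]

theorem norm_inverse_eq {L M : E2 →L[ℝ] E2} (hL : AreaPreserving L)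
    (h : ∀ x, L (M x) = x) (hM : AreaPreserving M) : ‖M‖ = ‖L‖ := by
  refine le_antisymm (M.opNorm_le_bound (norm_nonneg _) fun x => ?_)
    (L.opNorm_le_bound (norm_nonneg _) fun x => ?_)
  · simpa [h] using hL.norm_le (M x)
  · obtain ⟨y, rfl⟩ := hM.surjective x
    rw [h]
    exact hM.norm_le y

theorem growthRate_neg (n : ℕ) (ω : Ω) :
    growthRate T (transfer T f E) (-(n : ℤ)) ω =
      growthRate T (transfer T f E) n ((T ^ (-(n : ℤ))) ω) := by
  rcases n with _ | n
  · simp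
  rw [growthRate, growthRate, Int.cast_neg, abs_neg]
  congr 2
  change opNorm (cocycleNeg T (transfer T f E) (n + 1) ω : GL (Fin 2) ℝ) =
    ‖propagator T f E (n + 1) ((T ^ (-((n + 1 : ℕ) : ℤ))) ω)‖
  have hL := areaPreserving_propagator T f E (n + 1) ((T ^ (-((n + 1 : ℕ) : ℤ))) ω)
  rw [cocycleNeg_eq, opNorm]
  have hLM : ∀ x, propagator T f E (n + 1) ((T ^ (-((n + 1 : ℕ) : ℤ))) ω)
      (Matrix.toEuclideanCLM (n := Fin 2) (𝕜 := ℝ) ((cocyclePos T (transfer T f E) (n + 1)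
        ((T ^ (-((n + 1 : ℕ) : ℤ))) ω))⁻¹ : GL (Fin 2) ℝ) x) = x := by
    intro x
    rw [propagator, ← mul_apply_eq_comp, ← map_mul, Units.mul_inv, map_one]
    rfl
  refine norm_inverse_eq hL hLM fun x y => ?_
  rw [← hL, hLM, hLM]

theorem eventually_absAtTop {p : ℤ → Prop} :
    (∀ᶠ n in absAtTop, p n) ↔ ∀ᶠ n : ℕ in atTop, p n ∧ p (-(n : ℤ)) := by
  rw [absAtTop, eventually_comap, eventually_atTop, eventually_atTop]
  constructor
  · rintro ⟨a, ha⟩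
    refine ⟨a.toNat, fun n hn => ⟨ha n (by lia) _ (by simp), ha n (by lia) _ (by simp)⟩⟩
  · rintro ⟨a, ha⟩
    refine ⟨a, fun b hb n hn => ?_⟩
    obtain ⟨h1, h2⟩ := ha n.natAbs (by rw [Int.abs_eq_natAbs] at hn; lia)
    rcases Int.natAbs_eq n with h | h
    · rwa [← h] at h1
    · rwa [← h] at h2

/-- An area-preserving map and its inverse have equal norms, so the rate at `-n` and `ω` is the rate
at `n` and `T⁻ⁿ ω`. Uniformity in `ω` makes the base point irrelevant. -/
theorem tendstoUniformly_growthRate_iff {L : ℝ} :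
    TendstoUniformly (growthRate T (transfer T f E)) (fun _ => L) absAtTop ↔
      TendstoUniformly (fun (n : ℕ) ω => (n : ℝ)⁻¹ * Real.log ‖propagator T f E n ω‖)
        (fun _ => L) atTop := by
  simp only [Metric.tendstoUniformly_iff, eventually_absAtTop, growthRate_neg, growthRate_natCast]
  refine forall₂_congr fun ε _ => eventually_congr (Eventually.of_forall fun n => ?_)
  exact ⟨fun h => h.1, fun h => ⟨h, fun ω => h _⟩⟩

theorem norm_propagator_pos (n : ℕ) (ω : Ω) : 0 < ‖propagator T f E n ω‖ :=
  zero_lt_one.trans_le (areaPreserving_propagator T f E n ω).one_le_norm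

theorem continuous_log_norm_propagator (n : ℕ) :
    Continuous fun ω => Real.log ‖propagator T f E n ω‖ :=
  (continuous_propagator T f E n).norm.log fun ω => (norm_propagator_pos n ω).ne'

end Growth

/-! ### Resolvent points have uniform cocycles with positive exponent. -/

section Uniform

variable {Ω : Type*} [MetricSpace Ω] [CompactSpace Ω] [MeasurableSpace Ω] [BorelSpace Ω]
  {T : Ω ≃ₜ Ω} {f : C(Ω, ℝ)} {E : ℝ}

theorem IsResolventPoint.isUniform {μ : Measure Ω} [IsProbabilityMeasure μ]
    (hμ : ∀ ν : Measure Ω, IsProbabilityMeasure ν → MeasurePreserving T ν ν → ν = μ)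
    (h : IsResolventPoint T f E) :
    IsUniform μ T (transfer T f E) ∧ 0 < lyapunov μ T f E := by
  obtain ⟨R, hR, hmul⟩ := exists_norm_mul_norm_le h
  have hR0 := Real.log_nonneg hR
  obtain ⟨L, hL⟩ := exists_tendstoUniformly_of_almostAdditive T.continuous hμ
    (a := fun n ω => Real.log ‖propagator T f E n ω‖) continuous_log_norm_propagator
    (C := Real.log R) fun m n ω => by
      have hB := norm_propagator_pos (T := T) (f := f) (E := E) n (T^[m] ω)
      have hC := norm_propagator_pos (T := T) (f := f) (E := E) m ω
      have hBC := norm_propagator_pos (T := T) (f := f) (E := E) (n + m) ω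
      have h1 := Real.log_le_log (by positivity) (hmul m n ω)
      rw [Real.log_mul hB.ne' hC.ne', Real.log_mul (by positivity) hBC.ne'] at h1
      have h2 : Real.log ‖propagator T f E (n + m) ω‖ ≤ Real.log ‖propagator T f E n (T^[m] ω)‖ +
          Real.log ‖propagator T f E m ω‖ := by
        rw [← Real.log_mul hB.ne' hC.ne']
        refine Real.log_le_log hBC ?_
        rw [propagator_add]
        exact ContinuousLinearMap.opNorm_comp_le _ _
      rw [abs_le]
      constructor <;> linarith
  have hunif := tendstoUniformly_growthRate_iff.2 hL
  have hLam : Lam μ T (transfer T f E) = L :=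
    Lam_eq (Eventually.of_forall fun ω => hunif.tendsto_at ω)
  refine ⟨by rw [IsUniform, hLam]; exact hunif, ?_⟩
  rw [lyapunov, hLam]
  obtain ⟨K, lam, hK, hlam, hlam1, hgrow⟩ := exists_one_le_mul_norm_sq_propagator h
  obtain ⟨ω⟩ : Nonempty Ω := nonempty_of_isProbabilityMeasure μ
  have hlog : Real.log lam < 0 := Real.log_neg hlam hlam1
  have hlim : Tendsto (fun n : ℕ => -(Real.log lam / 2) - Real.log K / 2 / n) atTop
      (𝓝 (-(Real.log lam / 2) - 0)) :=
    tendsto_const_nhds.sub (tendsto_const_div_atTop_nhds_zero_nat _)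
  -- Taking logarithms in `1 ≤ K lam^n ‖·‖²` bounds the exponent below by `-log lam / 2 > 0`.
  have hle : -(Real.log lam / 2) - 0 ≤ L := by
    refine le_of_tendsto_of_tendsto hlim (hL.tendsto_at ω) ?_
    filter_upwards [eventually_gt_atTop 0] with n hn
    have hn' : (0 : ℝ) < n := by exact_mod_cast hn
    have hP := norm_propagator_pos (T := T) (f := f) (E := E) n ω
    have h1 := Real.log_nonneg (hgrow n ω)
    rw [Real.log_mul (by positivity) (by positivity), Real.log_mul (by positivity) (by positivity),
      Real.log_pow, Real.log_pow] at h1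
    push_cast at h1
    rw [inv_mul_eq_div, le_div_iff₀ hn', sub_mul, div_mul_cancel₀ _ hn'.ne']
    linarith
  linarith

end Uniform

/-! ### Uniform positive growth implies the resolvent bound. -/

section Converse

local notation "E2" => EuclideanSpace ℝ (Fin 2)

variable {Ω : Type*} [TopologicalSpace Ω] {T : Ω ≃ₜ Ω} {f : C(Ω, ℝ)} {E : ℝ}

/-- Uniform positive growth makes every vector be dominated by its far future or its far past. -/
theorem exists_norm_propagator_le_eighth {L : ℝ} (hL0 : 0 < L)
    (hL : TendstoUniformly (fun (n : ℕ) ω => (n : ℝ)⁻¹ * Real.log ‖propagator T f E n ω‖)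
        (fun _ => L) atTop) :
    ∃ N : ℕ, ∀ ω x, ‖propagator T f E N ω x‖ ≤
      1 / 8 * (‖propagator T f E (2 * N) ω x‖ + ‖x‖) := by
  -- With tolerance `L / 10` and `t = exp (N L / 10)`, the norms at time `N` lie in `[t^9, t^11]`
  -- and at time `2N` exceed `t^18`. Quotients of the former are at most `t^2`, and `t ≥ 2` gives
  -- `t^18 ≥ 128 t^11`, which beats all error terms.
  obtain ⟨n₀, hn₀⟩ := eventually_atTop.1
    (Metric.tendstoUniformly_iff.1 hL (L / 10) (by positivity))
  have ht : Tendsto (fun N : ℕ => Real.exp (N * (L / 10))) atTop atTop :=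
    Real.tendsto_exp_atTop.comp
      (tendsto_natCast_atTop_atTop.atTop_mul_const (by positivity))
  obtain ⟨N, hN⟩ := ((ht.eventually_ge_atTop 2).and
    ((eventually_ge_atTop n₀).and (eventually_gt_atTop 0))).exists
  obtain ⟨ht2, hNn, hN0⟩ := hN
  refine ⟨N, fun ω x => ?_⟩
  have hbounds : ∀ n ≥ N, ∀ ω, Real.exp (9 * (n * (L / 10))) ≤ ‖propagator T f E n ω‖ ∧
      ‖propagator T f E n ω‖ ≤ Real.exp (11 * (n * (L / 10))) := by
    intro n hn ω
    have h1 := hn₀ n (hNn.trans hn) ω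
    have hn' : (0 : ℝ) < n := by exact_mod_cast hN0.trans_le hn
    rw [Real.dist_eq, abs_lt, inv_mul_eq_div] at h1
    have h2 : Real.log ‖propagator T f E n ω‖ < (L + L / 10) * n := by
      rw [← div_lt_iff₀ hn']; linarith
    have h3 : (L - L / 10) * n < Real.log ‖propagator T f E n ω‖ := by
      rw [← lt_div_iff₀ hn']; linarith
    have hpos := norm_propagator_pos (T := T) (f := f) (E := E) n ω
    exact ⟨(Real.le_log_iff_exp_le hpos).1 (by linarith),
      (Real.log_le_iff_le_exp hpos).1 (by linarith)⟩
  have hC := hbounds N le_rfl ω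
  have hB := hbounds N le_rfl (T^[N] ω)
  have hBC := (hbounds (2 * N) (by lia) ω).1
  have hexp : ∀ k : ℕ, Real.exp (k * (N * (L / 10))) = Real.exp (N * (L / 10)) ^ k := fun k => by
    rw [← Real.exp_nat_mul]
  have h9 := hexp 9
  have h11 := hexp 11
  have h18 : Real.exp (9 * ((2 * N : ℕ) * (L / 10))) = Real.exp (N * (L / 10)) ^ 18 := by
    rw [← hexp]; congr 1; push_cast; ring
  push_cast at h9 h11
  rw [h9, h11] at hC hB
  rw [h18] at hBC
  have hmain := norm_apply_le_of_product (areaPreserving_propagator T f E N (T^[N] ω))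
    (areaPreserving_propagator T f E N ω) x
  rw [← propagator_add, ← two_mul, propagator_add_apply, ← two_mul] at hmain
  have hb0 := norm_propagator_pos (T := T) (f := f) (E := E) N (T^[N] ω)
  have hc0 := norm_propagator_pos (T := T) (f := f) (E := E) N ω
  generalize Real.exp (N * (L / 10)) = t at *
  generalize ‖propagator T f E N (T^[N] ω)‖ = b at *
  generalize ‖propagator T f E N ω‖ = c at *
  have ht0 : 0 < t := by linarith
  have hratio : ∀ {p q : ℝ}, 0 < q → p ≤ t ^ 11 → t ^ 9 ≤ q → p / q ≤ t ^ 2 := by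
    intro p q hq hp hq'
    rw [div_le_iff₀ hq]
    calc p ≤ t ^ 2 * t ^ 9 := by rwa [← pow_add]
      _ ≤ t ^ 2 * q := by gcongr
  have hD : 8 * t ^ 11 ≤ ‖propagator T f E (2 * N) ω‖ - c / b - b / c := by
    have h1 := hratio hb0 hC.2 hB.1
    have h2 := hratio hc0 hB.2 hC.1
    have h3 : t ^ 2 ≤ t ^ 11 := pow_le_pow_right₀ (by linarith) (by norm_num)
    have h4 : (128 : ℝ) ≤ t ^ 7 := by
      calc (128 : ℝ) = 2 ^ 7 := by norm_num
        _ ≤ t ^ 7 := by gcongr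
    have h5 : 128 * t ^ 11 ≤ t ^ 18 := by
      calc _ ≤ t ^ 7 * t ^ 11 := by gcongr
        _ = t ^ 18 := by ring
    have h6 : 0 < t ^ 11 := by positivity
    linarith
  have hpos : 0 < t ^ 11 := by positivity
  have h1 : t ^ 11 * (8 * ‖propagator T f E N ω x‖) ≤
      t ^ 11 * (‖propagator T f E (2 * N) ω x‖ + ‖x‖) := by
    calc _ = 8 * t ^ 11 * ‖propagator T f E N ω x‖ := by ring
      _ ≤ _ := mul_le_mul_of_nonneg_right hD (norm_nonneg _)
      _ ≤ _ := hmain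
      _ ≤ t ^ 11 * ‖propagator T f E (2 * N) ω x‖ + t ^ 11 * ‖x‖ := by
        gcongr
        exacts [hC.2, hB.2]
      _ = _ := by ring
  have := le_of_mul_le_mul_left h1 hpos
  linarith

variable (T f E) in
/-- The residual `(H_ω - E) φ` of a real sequence. -/
noncomputable def residual (ω : Ω) (φ : ℤ → ℝ) (n : ℤ) : ℝ :=
  φ (n + 1) + φ (n - 1) + f ((T ^ n) ω) * φ n - E * φ n

/-- A discrete Duhamel estimate: each step adds the residual to the first coordinate, and the later
steps magnify it by at most `g` each. -/
theorem norm_sub_propagator_le {g : ℝ} (hg : 1 ≤ g) (hgn : ∀ ω, ‖propagator T f E 1 ω‖ ≤ g)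
    (ω : Ω) (φ : ℤ → ℝ) (n : ℤ) (k : ℕ) :
    ‖(!₂[φ (n + k + 1), φ (n + k)] : E2) -
        propagator T f E k ((T ^ n) ω) (!₂[φ (n + 1), φ n] : E2)‖ ≤
      g ^ k * ∑ j ∈ Finset.range k, |residual T f E ω φ (n + j + 1)| := by
  induction k with
  | zero => simp
  | succ k ih =>
    obtain ⟨y, hy⟩ : ∃ y, y = propagator T f E k ((T ^ n) ω) (!₂[φ (n + 1), φ n] : E2) := ⟨_, rfl⟩
    have hsplit : (!₂[φ (n + (k + 1 : ℕ) + 1), φ (n + (k + 1 : ℕ))] : E2) -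
        propagator T f E (k + 1) ((T ^ n) ω) (!₂[φ (n + 1), φ n] : E2) =
        propagator T f E 1 (T^[k] ((T ^ n) ω)) ((!₂[φ (n + k + 1), φ (n + k)] : E2) - y) +
          EuclideanSpace.single 0 (residual T f E ω φ (n + k + 1)) := by
      have hT : (T ^ (n + k + 1)) ω = T^[k + 1] ((T ^ n) ω) := by
        rw [← homeomorph_zpow_natCast, ← Homeomorph.mul_apply, ← zpow_add]
        congr 2; push_cast; ring
      have e1 : n + ((k + 1 : ℕ) : ℤ) = n + k + 1 := by push_cast; ring
      rw [hy, map_sub, propagator_add_apply, add_comm 1 k, e1, sub_add_eq_add_sub]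
      congr 1
      apply ext_coords
      · have := propagator_succ_apply_zero T f E 0 (T^[k] ((T ^ n) ω))
          (!₂[φ (n + k + 1), φ (n + k)] : E2)
        rw [← Function.iterate_add_apply, zero_add, add_comm 1 k, ← hT] at this
        simp only [PiLp.add_apply, this]
        simp [residual]
        ring
      · have := propagator_succ_apply_one T f E 0 (T^[k] ((T ^ n) ω))
          (!₂[φ (n + k + 1), φ (n + k)] : E2)
        rw [zero_add] at this
        simp only [PiLp.add_apply, this]
        simp
    rw [← hy] at ih
    rw [hsplit, Finset.sum_range_succ, mul_add]
    refine (norm_add_le _ _).trans (add_le_add ?_ ?_)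
    · rw [pow_succ', mul_assoc]
      exact (ContinuousLinearMap.le_opNorm _ _).trans
        (mul_le_mul (hgn _) ih (norm_nonneg _) (by linarith))
    · rw [PiLp.norm_single, Real.norm_eq_abs]
      exact le_mul_of_one_le_left (abs_nonneg _) (one_le_pow₀ hg)

theorem exists_tsum_sq_le [CompactSpace Ω] {N : ℕ}
    (hN : ∀ ω x, ‖propagator T f E N ω x‖ ≤
      1 / 8 * (‖propagator T f E (2 * N) ω x‖ + ‖x‖)) :
    ∃ M > 0, ∀ ω (φ : ℤ → ℝ), Summable (fun n => φ n ^ 2) →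
      Summable (fun n => residual T f E ω φ n ^ 2) →
      ∑' n, φ n ^ 2 ≤ M * ∑' n, residual T f E ω φ n ^ 2 := by
  obtain ⟨g, hg, hgn⟩ := exists_norm_propagator_le T f E
  have hg1 : ∀ ω, ‖propagator T f E 1 ω‖ ≤ g := fun ω => by simpa using hgn 1 ω
  refine ⟨12 * (g ^ (2 * N)) ^ 2 * (2 * N : ℕ) * (2 * N : ℕ) + 1, by positivity,
    fun ω φ hφ hr => ?_⟩
  set r := residual T f E ω φ with hrdef
  let x : ℤ → E2 := fun n => !₂[φ (n + 1), φ n]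
  have hx : ∀ n, ‖x n‖ ^ 2 = φ (n + 1) ^ 2 + φ n ^ 2 := fun n => by
    rw [norm_sq_eq_coords]; simp [x]
  -- This is the `1/8` estimate with Duhamel errors, squared by `(a + b + c)² ≤ 3(a² + b² + c²)`.
  -- Summed over `n`, the two main terms amount to `6/64` of the left side and are absorbed.
  have hstep : ∀ n : ℤ, ‖x (n + N)‖ ^ 2 ≤ 3 / 64 * (‖x (n + (2 * N : ℕ))‖ ^ 2 + ‖x n‖ ^ 2) +
      12 * (g ^ (2 * N)) ^ 2 * ((2 * N : ℕ) * ∑ j ∈ Finset.range (2 * N), r (n + j + 1) ^ 2) := by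
    intro n
    have h1 := norm_sub_propagator_le hg hg1 ω φ n N
    have h2 := norm_sub_propagator_le hg hg1 ω φ n (2 * N)
    have h3 := hN ((T ^ n) ω) (x n)
    rw [← hrdef] at h1 h2
    have hsq : (∑ j ∈ Finset.range (2 * N), |r (n + j + 1)|) ^ 2 ≤
        (2 * N : ℕ) * ∑ j ∈ Finset.range (2 * N), r (n + j + 1) ^ 2 := by
      have := sq_sum_le_card_mul_sum_sq (s := Finset.range (2 * N))
        (f := fun j : ℕ => |r (n + j + 1)|)
      simpa only [sq_abs, Finset.card_range] using this
    have hle : g ^ N * ∑ j ∈ Finset.range N, |r (n + j + 1)| ≤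
        g ^ (2 * N) * ∑ j ∈ Finset.range (2 * N), |r (n + j + 1)| := by
      refine mul_le_mul (pow_le_pow_right₀ hg (by lia)) ?_
        (Finset.sum_nonneg fun _ _ => abs_nonneg _) (by positivity)
      exact Finset.sum_le_sum_of_subset_of_nonneg (Finset.range_mono (by lia))
        fun _ _ _ => abs_nonneg _
    have h1' : ‖x (n + N)‖ ≤ ‖propagator T f E N ((T ^ n) ω) (x n)‖ +
        g ^ (2 * N) * ∑ j ∈ Finset.range (2 * N), |r (n + j + 1)| :=
      (norm_le_norm_add_norm_sub' _ _).trans (add_le_add_right (h1.trans hle) _)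
    have h2' : ‖propagator T f E (2 * N) ((T ^ n) ω) (x n)‖ ≤ ‖x (n + (2 * N : ℕ))‖ +
        g ^ (2 * N) * ∑ j ∈ Finset.range (2 * N), |r (n + j + 1)| :=
      (norm_le_norm_add_norm_sub _ _).trans (add_le_add_right h2 _)
    have hR : 0 ≤ ∑ j ∈ Finset.range (2 * N), |r (n + j + 1)| :=
      Finset.sum_nonneg fun _ _ => abs_nonneg _
    have hG : 0 < g ^ (2 * N) := by positivity
    generalize ∑ j ∈ Finset.range (2 * N), |r (n + j + 1)| = R at *
    generalize g ^ (2 * N) = G at *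
    have h4 : ‖x (n + N)‖ ≤ 1 / 8 * ‖x (n + (2 * N : ℕ))‖ + 1 / 8 * ‖x n‖ + 2 * (G * R) := by
      have : 0 ≤ G * R := by positivity
      linarith
    calc ‖x (n + N)‖ ^ 2 ≤ (1 / 8 * ‖x (n + (2 * N : ℕ))‖ + 1 / 8 * ‖x n‖ + 2 * (G * R)) ^ 2 :=
          pow_le_pow_left₀ (norm_nonneg _) h4 2
      _ ≤ 3 / 64 * (‖x (n + (2 * N : ℕ))‖ ^ 2 + ‖x n‖ ^ 2) + 12 * G ^ 2 * R ^ 2 := by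
        generalize ‖x (n + (2 * N : ℕ))‖ = p
        generalize ‖x n‖ = q
        nlinarith [sq_nonneg (p - q), sq_nonneg (1 / 8 * p - 2 * (G * R)),
          sq_nonneg (1 / 8 * q - 2 * (G * R))]
      _ ≤ _ := by gcongr
  have hsh : ∀ (h : ℤ → ℝ) (k : ℤ), ∑' n, h (n + k) = ∑' n, h n := fun h k =>
    (Equiv.addRight k).tsum_eq h
  have hss : ∀ {h : ℤ → ℝ} (k : ℤ), Summable h → Summable fun n => h (n + k) := fun k hh =>
    (Equiv.addRight k).summable_iff.2 hh
  have hxs : Summable fun n => ‖x n‖ ^ 2 := by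
    simp only [hx]; exact (hss 1 hφ).add hφ
  have hxsum : ∑' n, ‖x n‖ ^ 2 = 2 * ∑' n, φ n ^ 2 := by
    simp only [hx]
    rw [(hss 1 hφ).tsum_add hφ, hsh (fun n => φ n ^ 2) 1]; ring
  have hrs : ∀ j : ℕ, Summable fun n : ℤ => r (n + j + 1) ^ 2 := fun j => by
    simpa only [add_assoc] using hss ((j : ℤ) + 1) hr
  have hrsum : ∑' n : ℤ, ∑ j ∈ Finset.range (2 * N), r (n + j + 1) ^ 2 =
      (2 * N : ℕ) * ∑' n, r n ^ 2 := by
    rw [Summable.tsum_finsetSum fun j _ => hrs j]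
    have : ∀ j : ℕ, ∑' n : ℤ, r (n + j + 1) ^ 2 = ∑' n, r n ^ 2 := fun j => by
      simpa only [add_assoc] using hsh (fun n => r n ^ 2) ((j : ℤ) + 1)
    simp only [this, Finset.sum_const, Finset.card_range, nsmul_eq_mul]
  have hA : Summable fun n : ℤ => 3 / 64 * (‖x (n + (2 * N : ℕ))‖ ^ 2 + ‖x n‖ ^ 2) :=
    ((hss _ hxs).add hxs).mul_left _
  have hBs : Summable fun n : ℤ => 12 * (g ^ (2 * N)) ^ 2 *
      ((2 * N : ℕ) * ∑ j ∈ Finset.range (2 * N), r (n + j + 1) ^ 2) :=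
    ((summable_sum fun j _ => hrs j).mul_left _).mul_left _
  have hsum := Summable.tsum_le_tsum hstep (hss N hxs) (hA.add hBs)
  rw [hA.tsum_add hBs, tsum_mul_left, tsum_mul_left, tsum_mul_left, hrsum,
    (hss (2 * N : ℕ) hxs).tsum_add hxs, hsh (fun n => ‖x n‖ ^ 2),
    hsh (fun n => ‖x n‖ ^ 2), hxsum] at hsum
  have hφ0 : 0 ≤ ∑' n, φ n ^ 2 := tsum_nonneg fun _ => sq_nonneg _
  have hr0 : 0 ≤ ∑' n, r n ^ 2 := tsum_nonneg fun _ => sq_nonneg _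
  linarith

theorem EllTwo.norm_sq_eq (u : EllTwo) :
    ‖u‖ ^ 2 = ∑' n, (u n).re ^ 2 + ∑' n, (u n).im ^ 2 ∧
      Summable (fun n => (u n).re ^ 2) ∧ Summable fun n => (u n).im ^ 2 := by
  have hs : Summable fun n => ‖u n‖ ^ 2 := by
    simpa using (memℓp_gen_iff two_toReal_pos).1 (lp.memℓp u)
  have hsplit : ∀ n, ‖u n‖ ^ 2 = (u n).re ^ 2 + (u n).im ^ 2 := fun n => by
    rw [Complex.sq_norm, Complex.normSq_apply]; ring
  have h1 : Summable (fun n => (u n).re ^ 2) :=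
    hs.of_nonneg_of_le (fun _ => sq_nonneg _) fun n => by
      rw [hsplit]; exact le_add_of_nonneg_right (sq_nonneg _)
  have h2 : Summable (fun n => (u n).im ^ 2) :=
    hs.of_nonneg_of_le (fun _ => sq_nonneg _) fun n => by
      rw [hsplit]; exact le_add_of_nonneg_left (sq_nonneg _)
  refine ⟨?_, h1, h2⟩
  have := lp.norm_rpow_eq_tsum two_toReal_pos u
  simp only [ENNReal.toReal_ofNat, Real.rpow_ofNat] at this
  rw [this, ← h1.tsum_add h2]
  exact tsum_congr hsplit

theorem isResolventPoint_of_tendstoUniformly [CompactSpace Ω] {L : ℝ} (hL0 : 0 < L)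
    (hL : TendstoUniformly (fun (n : ℕ) ω => (n : ℝ)⁻¹ * Real.log ‖propagator T f E n ω‖)
        (fun _ => L) atTop) : IsResolventPoint T f E := by
  obtain ⟨N, hN⟩ := exists_norm_propagator_le_eighth hL0 hL
  obtain ⟨M, hM, hle⟩ := exists_tsum_sq_le hN
  refine ⟨(Real.sqrt M)⁻¹, by positivity, fun ω u => ?_⟩
  obtain ⟨w, hw⟩ : ∃ w, w = schrodinger T f ω u - (E : ℂ) • u := ⟨_, rfl⟩
  have hwn : ∀ n, w n = u (n + 1) + u (n - 1) + (f ((T ^ n) ω) : ℂ) * u n - (E : ℂ) * u n :=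
    fun n => by rw [hw]; rfl
  -- `H_ω - E` has real coefficients, so the real estimate applies to real and imaginary parts
  -- separately.
  have hre : ∀ n, (w n).re = residual T f E ω (fun n => (u n).re) n := fun n => by
    simp [hwn, residual]
  have him : ∀ n, (w n).im = residual T f E ω (fun n => (u n).im) n := fun n => by
    simp [hwn, residual]
  obtain ⟨hu, hu1, hu2⟩ := EllTwo.norm_sq_eq u
  obtain ⟨hw', hw1, hw2⟩ := EllTwo.norm_sq_eq w
  simp only [hre, him] at hw' hw1 hw2
  have h1 := hle ω _ hu1 hw1
  have h2 := hle ω _ hu2 hw2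
  rw [← hw, inv_mul_le_iff₀ (by positivity)]
  refine (abs_le_of_sq_le_sq' ?_ (by positivity)).2
  rw [mul_pow, Real.sq_sqrt hM.le, hu, hw', mul_add]
  exact add_le_add h1 h2

end Converse

end ErgodicSchrodinger

theorem mainTheorem6 {Ω : Type*} [MetricSpace Ω] [CompactSpace Ω] [MeasurableSpace Ω]
    [BorelSpace Ω] (T : Ω ≃ₜ Ω) (hT : ErgodicSchrodinger.IsStrictlyErgodic T)
    (μ : Measure Ω) (hμ : IsProbabilityMeasure μ) (hμT : MeasurePreserving T μ μ)
    (f : C(Ω, ℝ)) :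
    ∃ S : Set ℝ,
      (∀ ω : Ω, spectrum ℂ (ErgodicSchrodinger.schrodinger T f ω) = Complex.ofReal '' S) ∧
      IsOpen Sᶜ ∧
      (∀ E ∈ Sᶜ, ErgodicSchrodinger.IsUniform μ T (ErgodicSchrodinger.transfer T f E) ∧
        0 < ErgodicSchrodinger.lyapunov μ T f E) ∧
      (∀ I : Set ℝ, IsOpen I →
        (∀ E ∈ I, ErgodicSchrodinger.IsUniform μ T (ErgodicSchrodinger.transfer T f E) ∧
          0 < ErgodicSchrodinger.lyapunov μ T f E) →
        I ⊆ Sᶜ) := by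
  have : Nonempty Ω := nonempty_of_isProbabilityMeasure μ
  have huniq : ∀ ν : Measure Ω, IsProbabilityMeasure ν → MeasurePreserving T ν ν → ν = μ :=
    fun ν h1 h2 => hT.existsUnique_measure.unique ⟨h1, h2⟩ ⟨hμ, hμT⟩
  have hcompl : {E | ¬ ErgodicSchrodinger.IsResolventPoint T f E}ᶜ =
      {E | ErgodicSchrodinger.IsResolventPoint T f E} := by
    ext; simp
  refine ⟨{E | ¬ ErgodicSchrodinger.IsResolventPoint T f E},
    ErgodicSchrodinger.spectrum_schrodinger_eq hT.dense_orbit, ?_⟩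
  rw [hcompl]
  refine ⟨ErgodicSchrodinger.isOpen_isResolventPoint hT.dense_orbit,
    fun E hE => ErgodicSchrodinger.IsResolventPoint.isUniform huniq hE, fun I _ hI E hE => ?_⟩
  exact ErgodicSchrodinger.isResolventPoint_of_tendstoUniformly (hI E hE).2
    (ErgodicSchrodinger.tendstoUniformly_growthRate_iff.1 (hI E hE).1)
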